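/- **Setting.** Let $\Sigma$ be a finite set of signals and $\Delta_\Sigma$ the set of probability distributions on $\Sigma$. The state of the world is a random variable $W$ with values in $\Delta_\Sigma$ and an arbitrary law $\mu$. There are infinitely many agents $0,1,2,\dots$; given $W=\omega$ their private signals $\Psi_0,\Psi_1,\dots$ are i.i.d. with law $\omega$. Agent $i$ uses a strategy $s_i$, which maps her signal to a probability distribution over reports $(\hat\sigma_i,\hat p_i)\in\Sigma\times\Delta_\Sigma$; given $W$, the pairs (signal, report) are independent across agents. Averages and fractions over the infinite population are limits of those over the first $n$ agents. Let $\hat W$ be the distribution of the agents' reported signals (only profiles $\mathbf s$ for which it almost surely exists are considered), $fr(a\mid\hat\sigma_{-i})$ the fraction of agents other than $i$ who report $a$, and $\hat\Psi$ the reported signal of an agent picked uniformly at random, i.e. $\Pr[\hat\Psi=a\mid \text{play}]=\hat W(a)$. Under truth-telling every agent $i$ reports $\Psi_i$ and her posterior $\mathbf q_{\Psi_i}$, where $\mathbf q_a(b)=\Pr[\Psi_j=b\mid\Psi_i=a]$ for $j\ne i$; then $\hat W=W$. **Payments.** Let $f$ be a real function that is convex on $(0,\infty)$ (its value at $0$,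 used when $\hat p_j(\hat\sigma_i)=0$ or $fr(\hat\sigma_i\mid\hat\sigma_{-i})=0$, is arbitrary) and $\alpha\in\mathbb R$. With a reference agent $j\neq i$ chosen uniformly at random, agent $i$ has the prediction score $\log\hat p_i(\hat\sigma_j)-\log fr(\hat\sigma_j\mid\hat\sigma_{-j})$ (with $\log 0=-\infty$; signals reported by a fraction $0$ of the agents do not contribute) and the information score $$f\!\left(\frac{\hat p_j(\hat\sigma_i)}{fr(\hat\sigma_i\mid\hat\sigma_{-i})}\right),$$ both averaged over the random choice of $j$, and is paid the prediction score plus $\alpha$ times the information score. The profile $\mathbf s$ is an equilibrium if every agent's expected payment is a finite real number and no agent can increase hers by changing her own strategy. The expected average information score of a profile is the expectation of the average over all agents of their information scores. **Mutual information.** $MI^f(X;Y)=D_f(U,V)$, where $U$ is the joint law of $(X,Y)$, $V$ is the product of its marginals and $D_f(p,q)=\sum p\,f(q/p)$ (for general laws, $\int f(dq/dp)\,dp$ plus $\lim_{t\to\infty}f(t)/t$ times the mass of the part of $q$ singular to $p$); $MI^f(X;Y\mid Z)=\sum_z\Pr[Z=z]\,MI^f(X;Y\mid Z=z)$. Expectations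 and $MI^f$ may take the value $+\infty$. **Support assumption.** Assume that either $f(t)/t\to0$ as $t\to\infty$ (as for $f=-\log$), or that almost surely, for all $a,b\in\Sigma$: if $W(a)>0$ and $\Pr[\Psi_0=a,\Psi_1=b]>0$, then $W(b)>0$ (for instance, $W$ almost surely has full support). **Theorem.** 1. Under truth-telling, for all $i\ne j$, the expected information score of agent $i$ and the expected average information score both equal $MI^f(W;\Psi_i\mid\Psi_j)$. 2. In every equilibrium, for every agent $j$, the expected average information score equals $MI^f(\hat W;\hat\Psi\mid\Psi_j)$. 3. In every equilibrium, the expected average information score is at most that of truth-telling. -/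

import Mathlib

open MeasureTheory ProbabilityTheory Filter Topology Set
open scoped ENNReal ProbabilityTheory

noncomputable section

namespace BTS

/-! ### Extended expectations and conditional `f`-mutual information -/

/-- Expectation of an extended-real random variable, as the expectation of the positive part minus
the expectation of the negative part. It agrees with the usual expectation whenever that exists in
`[-∞, ∞]`; the undefined case `∞ - ∞` gets the value `⊥`. -/
def expect {Ω : Type*} [MeasurableSpace Ω] (P : Measure Ω) (g : Ω → EReal) : EReal :=
  ((∫⁻ x, (g x).toENNReal ∂P : ℝ≥0∞) : EReal) - ((∫⁻ x, (-g x).toENNReal ∂P : ℝ≥0∞) : EReal)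

/-- The asymptotic slope `f'(∞) = lim f(t) / t` of a function (the limit exists in `(-∞, ∞]` when
`f` is convex on the positive reals). -/
def slopeAtTop (f : ℝ → ℝ) : EReal := limsup (fun t : ℝ => ((f t / t : ℝ) : EReal)) atTop

/-- The `f`-divergence `D_f(p, q) = ∑ p f(q / p)` of general measures. The part of `q` that
is singular to `p` enters with the usual convention `0 · f(a / 0) = a f'(∞)`. -/
def fDiv {α : Type*} [MeasurableSpace α] (f : ℝ → ℝ) (p q : Measure α) : EReal :=
  expect p (fun x => ((f (q.rnDeriv p x).toReal : ℝ) : EReal))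
    + slopeAtTop f * ((q.singularPart p univ : ℝ≥0∞) : EReal)

/-- `MI^f(X; Y) = D_f(U, V)`, where `U` is the joint law of `(X, Y)` and `V` is the product of its
marginals, as a function of the joint law. -/
def fMI {α β : Type*} [MeasurableSpace α] [MeasurableSpace β] (f : ℝ → ℝ)
    (U : Measure (α × β)) : EReal :=
  fDiv f U (U.fst.prod U.snd)

/-- `MI^f(X; Y | Z) = ∑_z Pr[Z = z] MI^f(X; Y | Z = z)` for a finitely-valued `Z`. -/
def condFMI {Ω α β γ : Type*} [MeasurableSpace Ω] [MeasurableSpace α] [MeasurableSpace β]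
    [Fintype γ] (f : ℝ → ℝ) (P : Measure Ω) (X : Ω → α) (Y : Ω → β) (Z : Ω → γ) : EReal :=
  ∑ z, ((P (Z ⁻¹' {z}) : ℝ≥0∞) : EReal)
    * fMI f (Measure.map (fun ω => (X ω, Y ω)) (P[|Z ⁻¹' {z}]))

/-! ### The game -/

/-- A report: a signal together with a prediction, i.e. a distribution over signals. -/
abbrev Report (S : Type*) [Fintype S] : Type _ := S × stdSimplex ℝ S

/-- A strategy maps the private signal to a probability distribution over reports. -/
abbrev Strategy (S : Type*) [Fintype S] [MeasurableSpace S] : Type _ :=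
  S → ProbabilityMeasure (Report S)

/-- A play of the game: the state of the world, and for each of the infinitely many agents
`0, 1, 2, …` her private signal and her report. -/
abbrev Play (S : Type*) [Fintype S] : Type _ := stdSimplex ℝ S × (ℕ → S × Report S)

section Game

variable {S : Type*} [Fintype S]

/-- The state of the world, a distribution over signals. -/
def state (x : Play S) : stdSimplex ℝ S := x.1

/-- The private signal of agent `i`. -/
def signal (i : ℕ) (x : Play S) : S := (x.2 i).1

/-- The signal reported by agent `i`. -/
def repSignal (i : ℕ) (x : Play S) : S := (x.2 i).2.1

/-- The prediction reported by agent `i`. -/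
def repPred (i : ℕ) (x : Play S) : stdSimplex ℝ S := (x.2 i).2.2

/-- The average of `g` over the infinite population of agents, with the finitely many agents in
`T` left out: the limit of the averages over the remaining agents among the first `n`. -/
def agentAvg (T : Finset ℕ) (g : ℕ → EReal) : EReal :=
  limsup (fun n : ℕ =>
    (∑ k ∈ Finset.range n \ T, g k) / (((Finset.range n \ T).card : ℝ) : EReal)) atTop

open Classical in
/-- The fraction of the agents outside `T` who report the signal `a`. With `T = {i}` this is
`fr(a | σ̂₋ᵢ)`. -/
def frac (T : Finset ℕ) (x : Play S) (a : S) : ℝ :=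
  (agentAvg T (fun k => if repSignal k x = a then 1 else 0)).toReal

/-- `Ŵ`: the distribution of the agents' reported signals. -/
def reportDist (x : Play S) : S → ℝ := frac ∅ x

lemma measurable_coord (a : S) : Measurable fun w : stdSimplex ℝ S => w a :=
  (measurable_pi_apply a).comp measurable_subtype_coe

lemma integrable_pair (μ : Measure (stdSimplex ℝ S)) [IsProbabilityMeasure μ] (a b : S) :
    Integrable (fun w : stdSimplex ℝ S => w a * w b) μ := by
  refine Integrable.of_bound ((measurable_coord a).mul (measurable_coord b)).aestronglyMeasurable
    1 (ae_of_all _ fun w => ?_)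
  have h : ∀ c, 0 ≤ w c ∧ w c ≤ 1 := fun c =>
    ⟨w.2.1 c, w.2.2 ▸ Finset.single_le_sum (fun d _ => w.2.1 d) (Finset.mem_univ c)⟩
  rw [Real.norm_of_nonneg (mul_nonneg (h a).1 (h b).1)]
  exact mul_le_one₀ (h a).2 (h b).1 (h b).2

variable [MeasurableSpace S]

/-- The law of (signal, report) of an agent with strategy `t`, given the state of the world `w`:
the signal is drawn from `w`, then the report from `t`. -/
def agentLaw (w : stdSimplex ℝ S) (t : Strategy S) : Measure (S × Report S) :=
  ∑ a, ENNReal.ofReal (w a) • (Measure.dirac a).prod (t a : Measure (Report S))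

instance agentLaw_prob (w : stdSimplex ℝ S) (t : Strategy S) :
    IsProbabilityMeasure (agentLaw w t) := by
  constructor
  simp only [agentLaw, Measure.coe_finsetSum, Finset.sum_apply, Measure.smul_apply,
    measure_univ, smul_eq_mul, mul_one]
  have h0 : ∀ a ∈ Finset.univ, 0 ≤ w a := fun a _ => w.2.1 a
  have h1 : ∑ a, w a = 1 := w.2.2
  rw [← ENNReal.ofReal_sum_of_nonneg h0, h1, ENNReal.ofReal_one]

/-- The law of the play given the state of the world `w`: the agents' (signal, report) pairs are
independent. -/
def lawGiven (s : ℕ → Strategy S) (w : stdSimplex ℝ S) : Measure (Play S) :=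
  Measure.map (fun y => (w, y)) (Measure.infinitePi fun i => agentLaw w (s i))

instance lawGiven_prob (s : ℕ → Strategy S) (w : stdSimplex ℝ S) :
    IsProbabilityMeasure (lawGiven s w) :=
  Measure.isProbabilityMeasure_map measurable_prodMk_left.aemeasurable

lemma measurable_lawGiven (s : ℕ → Strategy S) : Measurable (lawGiven s) := by
  have h : Measurable fun w : stdSimplex ℝ S => Measure.infinitePi fun i => agentLaw w (s i) := by
    refine .measure_of_isPiSystem_of_isProbabilityMeasure generateFrom_squareCylinders.symm
      (isPiSystem_squareCylinders (fun _ => MeasurableSpace.isPiSystem_measurableSet)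
        fun _ => (MeasurableSet.univ : MeasurableSet (univ : Set (S × Report S)))) ?_
    rintro _ ⟨T, t, ht, rfl⟩
    have ht' : ∀ i, MeasurableSet (t i) := fun i => ht i (mem_univ i)
    simp_rw [Measure.infinitePi_pi _ fun i _ => ht' i]
    refine Finset.measurable_prod _ fun i _ => ?_
    simp only [agentLaw, Measure.coe_finsetSum, Finset.sum_apply, Measure.smul_apply, smul_eq_mul]
    exact Finset.measurable_sum _ fun a _ => (measurable_coord a).ennreal_ofReal.mul_const _
  let κ : Kernel (stdSimplex ℝ S) (ℕ → S × Report S) := ⟨_, h⟩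
  have : IsMarkovKernel κ := ⟨fun w => by change IsProbabilityMeasure (Measure.infinitePi _); infer_instance⟩
  convert (Kernel.id ×ₖ κ).measurable using 1
  ext1 w
  rw [Kernel.prod_apply, Kernel.id_apply, Measure.dirac_prod]
  rfl

/-- The law of the play when the state of the world has law `μ` (this determines the common
symmetric prior over signals) and the agents use the strategy profile `s`. -/
def playLaw (μ : Measure (stdSimplex ℝ S)) (s : ℕ → Strategy S) : Measure (Play S) :=
  μ.bind (lawGiven s)

/-- The information score of agent `i` when `j` is the reference agent,
`f(p̂_j(σ̂ᵢ) / fr(σ̂ᵢ | σ̂₋ᵢ))`. -/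
def infoScoreRef (f : ℝ → ℝ) (i j : ℕ) (x : Play S) : ℝ :=
  f (repPred j x (repSignal i x) / frac {i} x (repSignal i x))

/-- The information score of agent `i`, averaged over the uniformly random reference agent
`j ≠ i`. -/
def infoScore (f : ℝ → ℝ) (i : ℕ) (x : Play S) : EReal :=
  agentAvg {i} (fun j => ((infoScoreRef f i j x : ℝ) : EReal))

/-- The prediction score of agent `i`, `log p̂ᵢ(σ̂_j) - log fr(σ̂_j | σ̂₋ⱼ)` with `log 0 = -∞`,
averaged over the uniformly random reference agent `j ≠ i`. The score depends on `j` only through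
the reported signal, which is `a` for a fraction `fr(a | σ̂₋ᵢ)` of the reference agents; leaving
out one agent does not change the limiting fraction, so that `fr(a | σ̂₋ⱼ)` is written as the
fraction among all agents. Signals that are reported by a vanishing fraction do not contribute. -/
def predScore (i : ℕ) (x : Play S) : EReal :=
  ∑ a, ((frac {i} x a : ℝ) : EReal) *
    (ENNReal.log (ENNReal.ofReal (repPred i x a)) - ENNReal.log (ENNReal.ofReal (reportDist x a)))

/-- The payment to agent `i`: prediction score plus `α` times information score. -/
def payment (α : ℝ) (f : ℝ → ℝ) (i : ℕ) (x : Play S) : EReal :=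
  predScore i x + (α : EReal) * infoScore f i x

/-- `s` is a Bayesian Nash equilibrium: the expected payment of every agent is a (finite) real
number, and no agent can increase hers by changing her strategy. -/
def IsEquilibrium (μ : Measure (stdSimplex ℝ S)) (α : ℝ) (f : ℝ → ℝ)
    (s : ℕ → Strategy S) : Prop :=
  ∀ i, expect (playLaw μ s) (payment α f i) ≠ ⊥ ∧ expect (playLaw μ s) (payment α f i) ≠ ⊤ ∧
    ∀ t : Strategy S, expect (playLaw μ (Function.update s i t)) (payment α f i)
      ≤ expect (playLaw μ s) (payment α f i)

/-- The distribution of the reported signals exists (almost surely): the fraction of the first `n`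
agents who report `a` converges for every signal `a`. -/
def HasReportDist (μ : Measure (stdSimplex ℝ S)) (s : ℕ → Strategy S) : Prop :=
  ∀ᵐ x ∂playLaw μ s, ∀ a, ∃ l : ℝ,
    Tendsto (fun n : ℕ => (({k ∈ (Iio n) | repSignal k x = a}.ncard : ℝ) / n)) atTop (𝓝 l)

/-- The expectation of the average, over all agents, of the information scores. -/
def expAvgInfoScore (μ : Measure (stdSimplex ℝ S)) (f : ℝ → ℝ) (s : ℕ → Strategy S) : EReal :=
  expect (playLaw μ s) (fun x => agentAvg ∅ (fun i => infoScore f i x))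

/-- The joint law of the play and the reported signal `Ψ̂` of an agent who is picked uniformly at
random: given the play, `Ψ̂ = a` with probability `Ŵ(a)`. -/
def pickLaw (μ : Measure (stdSimplex ℝ S)) (s : ℕ → Strategy S) : Measure (Play S × S) :=
  ∑ a, Measure.map (fun x => (x, a))
    ((playLaw μ s).withDensity fun x => ENNReal.ofReal (reportDist x a))

/-! ### Truth-telling -/

/-- `q(a)`, the prior probability that a given agent receives the signal `a`. -/
def priorProb (μ : Measure (stdSimplex ℝ S)) (a : S) : ℝ := ∫ w, w a ∂μ

/-- The prior probability that two given distinct agents receive `a` and `b`. -/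
def pairProb (μ : Measure (stdSimplex ℝ S)) (a b : S) : ℝ := ∫ w, w a * w b ∂μ

open Classical in
/-- `q_a`: the posterior distribution of another agent's signal given that one's own signal is `a`
(and the point mass at `a` if `a` has probability zero, which is immaterial). -/
def posterior (μ : Measure (stdSimplex ℝ S)) [IsProbabilityMeasure μ] (a : S) : stdSimplex ℝ S :=
  if h : priorProb μ a = 0 then stdSimplex.vertex a
  else ⟨fun b => pairProb μ a b / priorProb μ a, by
    constructor
    · intro b
      exact div_nonneg (integral_nonneg fun w => mul_nonneg (w.2.1 a) (w.2.1 b))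
        (integral_nonneg fun w => w.2.1 a)
    · rw [← Finset.sum_div, div_eq_one_iff_eq h]
      simp only [pairProb, priorProb]
      rw [← integral_finsetSum _ fun b _ => integrable_pair μ a b]
      refine integral_congr_ae (ae_of_all _ fun w => ?_)
      have hw : ∑ b, w b = 1 := w.2.2
      simp only [← Finset.mul_sum, hw, mul_one]⟩

/-- Truth-telling: every agent reports her private signal and her posterior. -/
def truth (μ : Measure (stdSimplex ℝ S)) [IsProbabilityMeasure μ] : ℕ → Strategy S :=
  fun _ a => ⟨Measure.dirac (a, posterior μ a), inferInstance⟩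

/-- Almost surely, every signal to which an agent's posterior gives positive probability has
positive probability in the true state of the world. (It holds, for instance, if almost every
state of the world has full support.) -/
def PosteriorSupported (μ : Measure (stdSimplex ℝ S)) : Prop :=
  ∀ᵐ w ∂μ, ∀ a b, 0 < w a → 0 < pairProb μ a b → 0 < w b

end Game

end BTS

end

/-!
The theorem reduces both sides of every claim to one functional of a channel `θ`, that is, of a
stochastic matrix that garbles the state: `garbledInfo μ f θ` is the expectation over the state `w`
of `∑ a, ∑ b, h a * w b * f (m b a / h a)`, where `h = garble θ w` is the garbled state and `m b` is
the garbled posterior, which is the posterior belief about `h` after the signal `b`.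

* *Reports are a garbling.* Whenever the distribution of the reported signals exists, it equals
  `garble θ w` for a limit point `θ` of the averages of the agents' reporting strategies
  (`HasReportDist.exists_channel`). Given the state, the variance of the empirical frequencies tends
  to zero, so that mean square convergence along a subsequence identifies the almost sure limit.
  Truth-telling corresponds to the noiseless channel.

* *Predictions are posteriors.* The prediction score is minus the Kullback-Leibler divergence of the
  prediction from `h` (`sum_mul_log_sub_log`). An agent who changes only her prediction leaves her
  information score unchanged, and by the compensation identity `lintegral_klTerm` the posterior is
  the unique best prediction. Payments have a finite expectation, but their two parts need not a
  priori; `lintegral_le_of_expect_le` deals with this. Hence `IsEquilibrium.ae_repPred_eq`.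

* *Information scores.* By the law of large numbers for the signals, the average information score
  in the state `w` is then `avgScore μ f θ w`, with expectation `garbledInfo μ f θ`
  (`expAvgInfoScore_eq`). It is well defined in `(-∞, ∞]`, because a convex function is bounded
  below by an affine one.

* *Mutual information.* Given `Ψ_j = b`, the joint law of the garbled state `h` and a signal drawn
  from it has density `h a` with respect to the law of `h` times counting measure. The density of
  the product of its marginals is therefore `m b a / h a`, and the singular part lives where
  `h a = 0` and `m b a > 0`. The latter does not contribute: either `f` has slope zero at infinity,
  or the support assumption rules it out. So the conditional mutual information is again
  `garbledInfo μ f θ` (`condFMI_eq_garbledInfo`).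

* *Comparison.* For almost every state, Jensen's inequality for the perspective of `f` gives
  `avgScore μ f θ w ≤ avgScore μ f idChannel w` (`ae_avgScore_le`). If `f t / t` tends to zero, the
  support assumption is not needed, since `f` is then nonincreasing and dropping the weight that posteriors
  put on signals impossible in the true state goes in the right direction.
-/

noncomputable section

namespace BTS

/-! ### Extended expectations -/

section Expect

variable {Ω Ω' : Type*} [MeasurableSpace Ω] [MeasurableSpace Ω'] {P : Measure Ω}

lemma expect_congr {g g' : Ω → EReal} (h : g =ᵐ[P] g') : expect P g = expect P g' := by
  have h1 : ∫⁻ x, (g x).toENNReal ∂P = ∫⁻ x, (g' x).toENNReal ∂P :=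
    lintegral_congr_ae (h.mono fun x hx => by simp only [hx])
  have h2 : ∫⁻ x, (-g x).toENNReal ∂P = ∫⁻ x, (-g' x).toENNReal ∂P :=
    lintegral_congr_ae (h.mono fun x hx => by simp only [hx])
  unfold expect
  rw [h1, h2]

lemma expect_mono {g g' : Ω → EReal} (h : ∀ᵐ x ∂P, g x ≤ g' x) : expect P g ≤ expect P g' := by
  refine EReal.sub_le_sub ?_ ?_
  · exact EReal.coe_ennreal_le_coe_ennreal_iff.2
      (lintegral_mono_ae (h.mono fun x hx => EReal.toENNReal_le_toENNReal hx))
  · exact EReal.coe_ennreal_le_coe_ennreal_iff.2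
      (lintegral_mono_ae (h.mono fun x hx =>
        EReal.toENNReal_le_toENNReal (EReal.neg_le_neg_iff.2 hx)))

lemma expect_map {φ : Ω → Ω'} (hφ : Measurable φ) {g : Ω' → EReal} (hg : Measurable g) :
    expect (P.map φ) g = expect P (fun x => g (φ x)) := by
  unfold expect
  rw [lintegral_map hg.ereal_toENNReal hφ, lintegral_map (f := fun x => (-g x).toENNReal) _ hφ]
  exact hg.neg.ereal_toENNReal

lemma coe_sub_coe_of_add_eq {p n U V : ℝ≥0∞} (h : p + V = U + n) (hn : n ≠ ⊤) (hV : V ≠ ⊤) :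
    (p : EReal) - n = (U : EReal) - V := by
  lift n to NNReal using hn
  lift V to NNReal using hV
  by_cases hU : U = ⊤
  · have hp : p = ⊤ := by
      rw [hU, top_add] at h
      simpa using h
    simp only [hU, hp, EReal.coe_ennreal_top, EReal.coe_nnreal_eq_coe_real,
      EReal.top_sub_coe]
  · have hp : p ≠ ⊤ := by
      intro hp
      rw [hp, top_add] at h
      exact ENNReal.add_ne_top.2 ⟨hU, ENNReal.coe_ne_top⟩ h.symm
    lift U to NNReal using hU
    lift p to NNReal using hp
    have h' : (p : ℝ) + V = U + n := by exact_mod_cast h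
    have : (p : ℝ) - n = U - V := by linarith
    simp only [EReal.coe_nnreal_eq_coe_real]
    exact_mod_cast this

/-- The extended expectation is additive for a difference of nonnegative functions of which the
subtracted one has finite integral. -/
lemma expect_sub {u v : Ω → ℝ≥0∞} (hu : AEMeasurable u P) (hv : AEMeasurable v P)
    (hfin : ∫⁻ x, v x ∂P ≠ ⊤) :
    expect P (fun x => (u x : EReal) - v x)
      = ((∫⁻ x, u x ∂P : ℝ≥0∞) : EReal) - ((∫⁻ x, v x ∂P : ℝ≥0∞) : EReal) := by
  have hvt : ∀ᵐ x ∂P, v x < ⊤ := ae_lt_top' hv hfin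
  have e1 : ∫⁻ x, ((u x : EReal) - v x).toENNReal ∂P = ∫⁻ x, (u x - v x) ∂P := by
    refine lintegral_congr fun x => ?_
    rw [EReal.toENNReal_sub (EReal.coe_ennreal_nonneg _), EReal.toENNReal_coe, EReal.toENNReal_coe]
  have e2 : ∫⁻ x, (-((u x : EReal) - v x)).toENNReal ∂P = ∫⁻ x, (v x - u x) ∂P := by
    refine lintegral_congr_ae (hvt.mono fun x hx => ?_)
    dsimp only
    rw [EReal.neg_sub (Or.inl (EReal.coe_ennreal_ne_bot _))
      (Or.inr (by simpa using hx.ne)), add_comm, ← sub_eq_add_neg,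
      EReal.toENNReal_sub (EReal.coe_ennreal_nonneg _), EReal.toENNReal_coe, EReal.toENNReal_coe]
  unfold expect
  rw [e1, e2]
  refine coe_sub_coe_of_add_eq ?_ (ne_top_of_le_ne_top hfin (lintegral_mono fun x => tsub_le_self))
    hfin
  rw [← lintegral_add_right' _ hv, ← lintegral_add_left' hu]
  refine lintegral_congr fun x => ?_
  rw [tsub_add_eq_max, add_tsub_eq_max]

lemma toENNReal_sub_toENNReal_neg (x : EReal) :
    (x.toENNReal : EReal) - ((-x).toENNReal : EReal) = x := by
  rcases le_total 0 x with h | h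
  · rw [EReal.coe_toENNReal h, EReal.toENNReal_of_nonpos (EReal.neg_le_zero.2 h)]
    simp
  · rw [EReal.toENNReal_of_nonpos h, EReal.coe_toENNReal (EReal.neg_nonneg.2 h)]
    simp

lemma neg_coe_add_eq (n : ℝ≥0∞) (b : EReal) :
    -(n : EReal) + b = (b.toENNReal : EReal) - (((-b).toENNReal + n : ℝ≥0∞) : EReal) := by
  by_cases hn : n = ⊤
  · simp [hn]
  lift n to NNReal using hn
  induction b with
  | bot => simp
  | top => simp [EReal.coe_nnreal_eq_coe_real, ← EReal.coe_neg]
  | coe b =>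
    have h := toENNReal_sub_toENNReal_neg (b : EReal)
    rw [EReal.real_coe_toENNReal, ← EReal.coe_neg, EReal.real_coe_toENNReal] at *
    rw [EReal.coe_ennreal_add, EReal.coe_ennreal_ofReal, EReal.coe_ennreal_ofReal] at *
    simp only [EReal.coe_nnreal_eq_coe_real]
    norm_cast at *
    linarith

lemma le_toENNReal_neg_add (n : ℝ≥0∞) (b : EReal) :
    n ≤ (-(-(n : EReal) + b)).toENNReal + b.toENNReal := by
  by_cases hn : n = ⊤
  · simp [hn]
  lift n to NNReal using hn
  induction b with
  | bot => simp
  | top => simp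
  | coe b =>
    simp only [EReal.coe_nnreal_eq_coe_real]
    rw [← EReal.coe_neg, ← EReal.coe_add, ← EReal.coe_neg, EReal.real_coe_toENNReal,
      EReal.real_coe_toENNReal]
    refine le_trans ?_ ENNReal.ofReal_add_le
    rw [show -(-(n : ℝ) + b) + b = n by ring, ENNReal.ofReal_coe_nnreal]

/-- If the payoff `-N + B` has a finite expectation and replacing the loss `N` by the integrable
loss `N'` does not improve it, then the expected loss `N` is at most `N'`. No
integrability of `N` or `B` alone is assumed. -/
lemma lintegral_le_of_expect_le {N N' : Ω → ℝ≥0∞} {B : Ω → EReal} (hN : Measurable N)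
    (hN' : Measurable N') (hB : Measurable B) (hfin : ∫⁻ x, N' x ∂P ≠ ⊤)
    (hbot : expect P (fun x => -(N x : EReal) + B x) ≠ ⊥)
    (htop : expect P (fun x => -(N x : EReal) + B x) ≠ ⊤)
    (hle : expect P (fun x => -(N' x : EReal) + B x)
      ≤ expect P (fun x => -(N x : EReal) + B x)) :
    ∫⁻ x, N x ∂P ≤ ∫⁻ x, N' x ∂P := by
  have hneg : ∫⁻ x, (-(-(N x : EReal) + B x)).toENNReal ∂P ≠ ⊤ := by
    intro h
    refine hbot ?_
    unfold expect
    rw [h, EReal.coe_ennreal_top, EReal.sub_top]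
  have hB0 : ∫⁻ x, (-B x).toENNReal ∂P ≠ ⊤ := by
    refine ne_top_of_le_ne_top hneg (lintegral_mono fun x => EReal.toENNReal_le_toENNReal ?_)
    rw [EReal.neg_le_neg_iff]
    calc -(N x : EReal) + B x ≤ 0 + B x :=
          add_le_add_left (EReal.neg_le_zero.2 (EReal.coe_ennreal_nonneg _)) _
      _ = B x := zero_add _
  have hBp : Measurable fun x => (B x).toENNReal := hB.ereal_toENNReal
  have hBn : Measurable fun x => (-B x).toENNReal := hB.neg.ereal_toENNReal
  have key : ∀ M : Ω → ℝ≥0∞, Measurable M → ∫⁻ x, M x ∂P ≠ ⊤ →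
      expect P (fun x => -(M x : EReal) + B x)
        = ((∫⁻ x, (B x).toENNReal ∂P : ℝ≥0∞) : EReal)
          - ((∫⁻ x, (-B x).toENNReal ∂P + ∫⁻ x, M x ∂P : ℝ≥0∞) : EReal) := by
    intro M hM hMfin
    simp_rw [neg_coe_add_eq]
    have hsum : ∫⁻ x, ((-B x).toENNReal + M x) ∂P
        = ∫⁻ x, (-B x).toENNReal ∂P + ∫⁻ x, M x ∂P := lintegral_add_left hBn _
    rw [expect_sub hBp.aemeasurable (v := fun x => (-B x).toENNReal + M x)
      (hBn.add hM).aemeasurable, hsum]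
    rw [hsum]
    exact ENNReal.add_ne_top.2 ⟨hB0, hMfin⟩
  have hB1 : ∫⁻ x, (B x).toENNReal ∂P ≠ ⊤ := by
    intro h
    rw [key N' hN' hfin, h, EReal.coe_ennreal_top] at hle
    have : ∫⁻ x, (-B x).toENNReal ∂P + ∫⁻ x, N' x ∂P ≠ ⊤ := ENNReal.add_ne_top.2 ⟨hB0, hfin⟩
    rw [EReal.top_sub (mt EReal.coe_ennreal_eq_top_iff.1 this), top_le_iff] at hle
    exact htop hle
  have hNfin : ∫⁻ x, N x ∂P ≠ ⊤ := by
    refine ne_top_of_le_ne_top (ENNReal.add_ne_top.2 ⟨hneg, hB1⟩) ?_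
    rw [← lintegral_add_right _ hBp]
    exact lintegral_mono fun x => le_toENNReal_neg_add _ _
  rw [key N hN hNfin, key N' hN' hfin] at hle
  generalize ∫⁻ x, N x ∂P = a at *
  generalize ∫⁻ x, N' x ∂P = b at *
  generalize ∫⁻ x, (B x).toENNReal ∂P = c at *
  generalize ∫⁻ x, (-B x).toENNReal ∂P = d at *
  lift a to NNReal using hNfin
  lift b to NNReal using hfin
  lift c to NNReal using hB1
  lift d to NNReal using hB0
  rw [← ENNReal.coe_add, ← ENNReal.coe_add] at hle
  simp only [EReal.coe_nnreal_eq_coe_real, ← EReal.coe_sub, EReal.coe_le_coe_iff,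
    NNReal.coe_add] at hle
  exact_mod_cast (by linarith : (a : ℝ) ≤ b)

end Expect

/-! ### Convex functions on the positive reals -/

section Convex

variable {f : ℝ → ℝ}

lemma exists_neg_le_of_convexOn (hf : ConvexOn ℝ (Ioi 0) f) :
    ∃ C : ℝ, 0 ≤ C ∧ ∀ t, 0 < t → -f t ≤ C * (1 + t) := by
  refine ⟨|f 1| + |2 * (f 1 - f (1 / 2))| + |f 2 - f 1|, by positivity, fun t ht => ?_⟩
  have h1 := neg_abs_le (f 1)
  have h2 := abs_le.1 (le_refl |2 * (f 1 - f (1 / 2))|)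
  have h3 := abs_le.1 (le_refl |f 2 - f 1|)
  have p1 := abs_nonneg (f 1)
  have p2 := abs_nonneg (2 * (f 1 - f (1 / 2)))
  have p3 := abs_nonneg (f 2 - f 1)
  rcases lt_trichotomy t 1 with h | h | h
  · have := hf.slope_mono_adjacent (mem_Ioi.2 ht) (mem_Ioi.2 (by norm_num : (0 : ℝ) < 2)) h
      (by norm_num : (1 : ℝ) < 2)
    rw [div_le_div_iff₀ (by linarith) (by norm_num)] at this
    nlinarith
  · subst h
    nlinarith
  · have := hf.slope_mono_adjacent (mem_Ioi.2 (by norm_num : (0 : ℝ) < 1 / 2)) (mem_Ioi.2 ht)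
      (by norm_num : (1 / 2 : ℝ) < 1) h
    rw [div_le_div_iff₀ (by norm_num) (by linarith)] at this
    nlinarith

/-- A convex function on the positive reals that grows sublinearly is nonincreasing, since a
positive secant slope would persist up to infinity. -/
lemma antitoneOn_of_tendsto_div (hf : ConvexOn ℝ (Ioi 0) f)
    (h : Tendsto (fun t => f t / t) atTop (𝓝 0)) : AntitoneOn f (Ioi 0) := by
  intro s hs t ht hst
  by_contra! hlt
  have hst' : s < t := lt_of_le_of_ne hst fun e => by simp [e] at hlt
  rw [mem_Ioi] at hs ht
  set σ := (f t - f s) / (t - s) with hσ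
  have hσpos : 0 < σ := div_pos (by linarith) (by linarith)
  have hlow : ∀ x, t < x → f t + σ * (x - t) ≤ f x := by
    intro x hx
    have := hf.slope_mono_adjacent (mem_Ioi.2 hs) (mem_Ioi.2 (ht.trans hx)) hst' hx
    rw [← hσ, le_div_iff₀ (by linarith)] at this
    linarith
  have hlim : Tendsto (fun x : ℝ => (f t - σ * t) / x + σ) atTop (𝓝 (0 + σ)) :=
    (tendsto_const_nhds.div_atTop tendsto_id).add_const _
  have := le_of_tendsto_of_tendsto hlim h ?_
  · linarith
  · filter_upwards [eventually_gt_atTop t] with x hx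
    have hx0 : 0 < x := ht.trans hx
    rw [div_add' _ _ _ hx0.ne', div_le_div_iff_of_pos_right hx0]
    linarith [hlow x hx]

lemma measurable_comp_of_nonneg {Ω : Type*} [MeasurableSpace Ω] (hf : ConvexOn ℝ (Ioi 0) f)
    {r : Ω → ℝ} (hr : Measurable r) (h0 : ∀ x, 0 ≤ r x) : Measurable fun x => f (r x) := by
  have hm : Measurable ((Ioi (0 : ℝ)).piecewise f (fun _ => f 0)) :=
    (hf.continuousOn isOpen_Ioi).measurable_piecewise continuousOn_const measurableSet_Ioi
  have : (fun x => f (r x)) = fun x => (Ioi (0 : ℝ)).piecewise f (fun _ => f 0) (r x) := by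
    funext x
    by_cases h : 0 < r x
    · rw [piecewise_eq_of_mem _ _ _ (mem_Ioi.2 h)]
    · rw [piecewise_eq_of_notMem _ _ _ (by simpa using h), le_antisymm (not_lt.1 h) (h0 x)]
  rw [this]
  exact hm.comp hr

/-- Jensen's inequality for the perspective of a convex function. The weights `y c` sitting on
`x c = 0` do not enter the right-hand side, so they must either vanish or only lower the left-hand
side. -/
lemma perspective_sum_le {ι : Type*} (T : Finset ι) (hf : ConvexOn ℝ (Ioi 0) f) {x y : ι → ℝ}
    (hx : ∀ c ∈ T, 0 ≤ x c) (hy : ∀ c ∈ T, 0 ≤ y c) (hxy : ∀ c ∈ T, 0 < x c → 0 < y c)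
    (h : AntitoneOn f (Ioi 0) ∨ ∀ c ∈ T, x c = 0 → y c = 0) :
    (∑ c ∈ T, x c) * f ((∑ c ∈ T, y c) / ∑ c ∈ T, x c) ≤ ∑ c ∈ T, x c * f (y c / x c) := by
  classical
  rcases (Finset.sum_nonneg hx).eq_or_lt with h0 | h0
  · have := (Finset.sum_eq_zero_iff_of_nonneg hx).1 h0.symm
    have h1 : ∑ c ∈ T, x c * f (y c / x c) = 0 :=
      Finset.sum_eq_zero fun c hc => by rw [this c hc, zero_mul]
    rw [← h0, h1, zero_mul]
  set X := ∑ c ∈ T, x c with hX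
  set F := T.filter fun c => 0 < x c with hF
  have hzero : ∀ c ∈ T, c ∉ F → x c = 0 := fun c hc hcF =>
    le_antisymm (not_lt.1 fun h => hcF (Finset.mem_filter.2 ⟨hc, h⟩)) (hx c hc)
  have hFx : ∀ c ∈ F, 0 < x c := fun c hc => (Finset.mem_filter.1 hc).2
  have hFT : ∀ c ∈ F, c ∈ T := fun c hc => (Finset.mem_filter.1 hc).1
  have sumF : ∀ g : ι → ℝ, (∀ c ∈ T, x c = 0 → g c = 0) → ∑ c ∈ T, g c = ∑ c ∈ F, g c := by
    intro g hg
    exact (Finset.sum_subset (Finset.filter_subset _ _)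
      fun c hc hcF => hg c hc (hzero c hc hcF)).symm
  have hXF : X = ∑ c ∈ F, x c := sumF x fun c _ h => h
  have hJ := hf.map_sum_le (t := F) (w := fun c => x c / X) (p := fun c => y c / x c)
    (fun c hc => div_nonneg (hFx c hc).le h0.le) (by rw [← Finset.sum_div, ← hXF, div_self h0.ne'])
    (fun c hc => mem_Ioi.2 (div_pos (hxy c (hFT c hc) (hFx c hc)) (hFx c hc)))
  have e1 : ∑ c ∈ F, (x c / X) • (y c / x c) = (∑ c ∈ F, y c) / X := by
    rw [Finset.sum_div]
    refine Finset.sum_congr rfl fun c hc => ?_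
    have := (hFx c hc).ne'
    simp only [smul_eq_mul]
    field_simp
  have e2 : X * ∑ c ∈ F, (x c / X) • f (y c / x c) = ∑ c ∈ T, x c * f (y c / x c) := by
    rw [sumF _ fun c _ h => by rw [h, zero_mul], Finset.mul_sum]
    refine Finset.sum_congr rfl fun c hc => ?_
    simp only [smul_eq_mul]
    field_simp
  have hne : F.Nonempty := by
    by_contra hne
    rw [Finset.not_nonempty_iff_eq_empty] at hne
    rw [hne, Finset.sum_empty] at hXF
    exact h0.ne' hXF
  have hFpos : 0 < (∑ c ∈ F, y c) / X :=
    div_pos (Finset.sum_pos (fun c hc => hxy c (hFT c hc) (hFx c hc)) hne) h0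
  have hmono : f ((∑ c ∈ T, y c) / X) ≤ f ((∑ c ∈ F, y c) / X) := by
    rcases h with h | h
    · have : (∑ c ∈ F, y c) / X ≤ (∑ c ∈ T, y c) / X :=
        div_le_div_of_nonneg_right (Finset.sum_le_sum_of_subset_of_nonneg
          (Finset.filter_subset _ _) fun c hc _ => hy c hc) h0.le
      exact h (mem_Ioi.2 hFpos) (mem_Ioi.2 (hFpos.trans_le this)) this
    · rw [sumF y h]
  rw [← e2]
  refine mul_le_mul_of_nonneg_left (hmono.trans ?_) h0.le
  rwa [e1] at hJ

end Convex

/-! ### The logarithmic prediction score -/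

section Log

open InformationTheory

/-- The contribution `h log (h / p) + p - h` of one signal to the Kullback-Leibler divergence of
the distribution with weight `p` from the one with weight `h`. The term `p - h`, which cancels
in the sum over all signals, makes each contribution nonnegative. -/
def klTerm (h p : ℝ) : ℝ≥0∞ :=
  if p = 0 then (if h = 0 then 0 else ⊤) else ENNReal.ofReal (p * klFun (h / p))

lemma measurable_klTerm {Ω : Type*} [MeasurableSpace Ω] {h p : Ω → ℝ} (hh : Measurable h)
    (hp : Measurable p) : Measurable fun x => klTerm (h x) (p x) := by
  unfold klTerm
  refine Measurable.ite (hp (measurableSet_singleton 0))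
    (Measurable.ite (hh (measurableSet_singleton 0)) measurable_const measurable_const) ?_
  exact (hp.mul (measurable_klFun.comp (hh.div hp))).ennreal_ofReal

lemma mul_klFun_div {h p : ℝ} (hh : 0 ≤ h) (hp : 0 < p) :
    p * klFun (h / p) = h * (Real.log h - Real.log p) + p - h := by
  rcases hh.eq_or_lt with rfl | hh
  · simp [klFun_zero]
  · rw [klFun_apply, Real.log_div hh.ne' hp.ne']
    field_simp

lemma eq_of_klTerm_eq_zero {h p : ℝ} (hh : 0 ≤ h) (hp : 0 ≤ p) (h0 : klTerm h p = 0) : h = p := by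
  unfold klTerm at h0
  split_ifs at h0 with h1 h2
  · rw [h1, h2]
  · exact absurd h0 ENNReal.top_ne_zero
  · have hp' : 0 < p := lt_of_le_of_ne hp (Ne.symm h1)
    have hd : 0 ≤ h / p := div_nonneg hh hp
    have h2 : p * klFun (h / p) = 0 :=
      le_antisymm (ENNReal.ofReal_eq_zero.1 h0) (mul_nonneg hp (klFun_nonneg hd))
    have h3 := (klFun_eq_zero_iff hd).1 ((mul_eq_zero.1 h2).resolve_left h1)
    rwa [div_eq_one_iff_eq h1] at h3

lemma integrable_mul_klFun {Ω : Type*} [MeasurableSpace Ω] {P : Measure Ω} [IsFiniteMeasure P]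
    {h : Ω → ℝ} (hh : Measurable h) (h0 : ∀ x, 0 ≤ h x) (h1 : ∀ x, h x ≤ 1) {p : ℝ} (hp : 0 < p) :
    Integrable (fun x => p * klFun (h x / p)) P := by
  obtain ⟨C, hC⟩ := (isCompact_Icc (a := (0 : ℝ)) (b := 1 / p)).exists_bound_of_continuousOn
    continuous_klFun.continuousOn
  refine Integrable.const_mul ?_ _
  refine Integrable.of_bound (measurable_klFun.comp (hh.div_const p)).aestronglyMeasurable C
    (ae_of_all _ fun x => hC _ ⟨div_nonneg (h0 x) hp.le, ?_⟩)
  exact div_le_div_of_nonneg_right (h1 x) hp.le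

/-- Compensation identity: the expected divergence of a random weight `h` from a constant `p` is the
expected divergence from the mean `m` plus the divergence of `m` from `p`. -/
lemma lintegral_klTerm {Ω : Type*} [MeasurableSpace Ω] {P : Measure Ω} [IsFiniteMeasure P]
    {h : Ω → ℝ} (hh : Measurable h) (h0 : ∀ x, 0 ≤ h x) (h1 : ∀ x, h x ≤ 1) {m p : ℝ} (hm : 0 ≤ m)
    (hp : 0 ≤ p) (hmean : ∫ x, h x ∂P = P.real univ * m) :
    ∫⁻ x, klTerm (h x) m ∂P ≠ ⊤ ∧
      ∫⁻ x, klTerm (h x) p ∂P = ∫⁻ x, klTerm (h x) m ∂P + P univ * klTerm m p := by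
  have hint : Integrable h P := Integrable.of_bound hh.aestronglyMeasurable 1
    (ae_of_all _ fun x => by rw [Real.norm_of_nonneg (h0 x)]; exact h1 x)
  rcases hm.eq_or_lt with rfl | hm
  · rw [mul_zero, integral_eq_zero_iff_of_nonneg h0 hint] at hmean
    have e : ∀ q : ℝ, ∫⁻ x, klTerm (h x) q ∂P = P univ * klTerm 0 q := fun q => by
      rw [lintegral_congr_ae (g := fun _ => klTerm 0 q) (hmean.mono fun x hx => by simp [hx]),
        lintegral_const, mul_comm]
    rw [e, e]
    simp [klTerm]
  have hmint := integrable_mul_klFun (P := P) hh h0 h1 hm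
  have em : ∀ {q : ℝ}, 0 < q → ∫⁻ x, klTerm (h x) q ∂P
      = ENNReal.ofReal (∫ x, q * klFun (h x / q) ∂P) := fun {q} hq => by
    rw [ofReal_integral_eq_lintegral_ofReal (integrable_mul_klFun hh h0 h1 hq)
      (ae_of_all _ fun x => mul_nonneg hq.le (klFun_nonneg (div_nonneg (h0 x) hq.le)))]
    simp only [klTerm, hq.ne', if_false]
  refine ⟨by rw [em hm]; exact ENNReal.ofReal_ne_top, ?_⟩
  rcases hp.eq_or_lt with rfl | hp
  · rcases eq_or_ne (P univ) 0 with hP | hP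
    · rw [Measure.measure_univ_eq_zero.1 hP]
      simp
    · have hpos : P {x | klTerm (h x) 0 = ⊤} ≠ 0 := by
        intro hz
        have hz' : ∀ᵐ x ∂P, h x = 0 := by
          refine measure_mono_null (fun x hx => ?_) hz
          simpa [klTerm] using hx
        rw [integral_eq_zero_of_ae hz'] at hmean
        have : 0 < P.real univ * m :=
          mul_pos (ENNReal.toReal_pos hP (measure_ne_top _ _)) hm
        exact this.ne hmean
      have hL : ∫⁻ x, klTerm (h x) 0 ∂P = ⊤ :=
        lintegral_eq_top_of_measure_eq_top_ne_zero
          (measurable_klTerm hh measurable_const).aemeasurable hpos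
      rw [hL, show klTerm m 0 = ⊤ by simp [klTerm, hm.ne'], ENNReal.mul_top hP, add_top]
  · have hk : klTerm m p = ENNReal.ofReal (p * klFun (m / p)) := by simp [klTerm, hp.ne']
    rw [em hm, em hp, hk, ← ENNReal.ofReal_toReal (measure_ne_top P univ),
      ← ENNReal.ofReal_mul ENNReal.toReal_nonneg, ← ENNReal.ofReal_add
        (integral_nonneg fun x => mul_nonneg hm.le (klFun_nonneg (div_nonneg (h0 x) hm.le)))
        (mul_nonneg ENNReal.toReal_nonneg
          (mul_nonneg hp.le (klFun_nonneg (div_nonneg hm.le hp.le))))]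
    congr 1
    have e : ∀ x, p * klFun (h x / p)
        = m * klFun (h x / m) + (h x * (Real.log m - Real.log p) + (p - m)) := fun x => by
      rw [mul_klFun_div (h0 x) hp, mul_klFun_div (h0 x) hm]
      ring
    simp_rw [e]
    rw [integral_add hmint (g := fun x => h x * (Real.log m - Real.log p) + (p - m))
        ((hint.mul_const _).add (integrable_const _)),
      integral_add (hint.mul_const _) (integrable_const _), integral_mul_const, hmean,
      integral_const, mul_klFun_div hm.le hp, smul_eq_mul, measureReal_def]
    ring

lemma sum_eq_bot_of_mem {ι : Type*} {T : Finset ι} {g : ι → EReal} {a : ι} (ha : a ∈ T)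
    (h : g a = ⊥) : ∑ c ∈ T, g c = ⊥ := by
  classical
  rw [← Finset.add_sum_erase T g ha, h, EReal.bot_add]

lemma coe_sum_real {ι : Type*} (T : Finset ι) (g : ι → ℝ) :
    ((∑ a ∈ T, g a : ℝ) : EReal) = ∑ a ∈ T, (g a : EReal) := by
  classical
  induction T using Finset.induction_on with
  | empty => simp
  | insert a T ha ih => rw [Finset.sum_insert ha, Finset.sum_insert ha, EReal.coe_add, ih]

/-- The logarithmic score of the prediction `p` against the distribution `h`, measured relative to
the prediction `h`, is minus the Kullback-Leibler divergence. -/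
lemma sum_mul_log_sub_log {S : Type*} [Fintype S] {h p : S → ℝ} (hh : h ∈ stdSimplex ℝ S)
    (hp : p ∈ stdSimplex ℝ S) :
    ∑ a, ((h a : ℝ) : EReal) *
        (ENNReal.log (ENNReal.ofReal (p a)) - ENNReal.log (ENNReal.ofReal (h a)))
      = -((∑ a, klTerm (h a) (p a) : ℝ≥0∞) : EReal) := by
  by_cases hex : ∃ a, h a ≠ 0 ∧ p a = 0
  · obtain ⟨a, ha, hpa⟩ := hex
    have hpos : 0 < h a := lt_of_le_of_ne (hh.1 a) (Ne.symm ha)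
    have hs : ∑ a, klTerm (h a) (p a) = ⊤ :=
      ENNReal.sum_eq_top.2 ⟨a, Finset.mem_univ a, by simp [klTerm, ha, hpa]⟩
    rw [hs, sum_eq_bot_of_mem (Finset.mem_univ a)]
    · simp
    · simp [hpa, EReal.coe_mul_bot_of_pos hpos]
  push Not at hex
  have hppos : ∀ a, h a ≠ 0 → 0 < p a := fun a ha => lt_of_le_of_ne (hp.1 a) (Ne.symm (hex a ha))
  have e1 : ∀ a, ((h a : ℝ) : EReal) *
        (ENNReal.log (ENNReal.ofReal (p a)) - ENNReal.log (ENNReal.ofReal (h a)))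
      = ((h a * (Real.log (p a) - Real.log (h a)) : ℝ) : EReal) := fun a => by
    by_cases ha : h a = 0
    · simp [ha]
    · rw [ENNReal.log_ofReal_of_pos (hppos a ha),
        ENNReal.log_ofReal_of_pos (lt_of_le_of_ne (hh.1 a) (Ne.symm ha))]
      norm_cast
  have e2 : ∀ a, klTerm (h a) (p a)
      = ENNReal.ofReal (h a * (Real.log (h a) - Real.log (p a)) + p a - h a) := fun a => by
    by_cases hpa : p a = 0
    · have ha : h a = 0 := by
        by_contra ha
        exact hex a ha hpa
      simp [klTerm, ha, hpa]
    · rw [← mul_klFun_div (hh.1 a) (lt_of_le_of_ne (hp.1 a) (Ne.symm hpa))]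
      simp [klTerm, hpa]
  have hnn : ∀ a, 0 ≤ h a * (Real.log (h a) - Real.log (p a)) + p a - h a := fun a => by
    by_cases ha : h a = 0
    · simp [ha, hp.1 a]
    · rw [← mul_klFun_div (hh.1 a) (hppos a ha)]
      exact mul_nonneg (hp.1 a) (klFun_nonneg (div_nonneg (hh.1 a) (hp.1 a)))
  simp_rw [e1, e2]
  rw [← ENNReal.ofReal_sum_of_nonneg fun a _ => hnn a, EReal.coe_ennreal_ofReal,
    max_eq_left (Finset.sum_nonneg fun a _ => hnn a), ← coe_sum_real, ← EReal.coe_neg]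
  congr 1
  rw [Finset.sum_sub_distrib, Finset.sum_add_distrib, hh.2, hp.2, add_sub_cancel_right,
    ← Finset.sum_neg_distrib]
  exact Finset.sum_congr rfl fun a _ => by ring

end Log

/-! ### Averages over the population -/

section Average

lemma agentAvg_eq_of_tendsto (T : Finset ℕ) {g : ℕ → ℝ} {L : ℝ}
    (h : Tendsto (fun n : ℕ => (∑ k ∈ Finset.range n, g k) / n) atTop (𝓝 L)) :
    agentAvg T (fun k => (g k : EReal)) = (L : EReal) := by
  have hT : ∀ᶠ n in atTop, T ⊆ Finset.range n := by
    obtain ⟨N, hN⟩ := T.exists_nat_subset_range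
    filter_upwards [eventually_ge_atTop N] with n hn
    exact hN.trans (Finset.range_mono hn)
  have hc : ∀ c : ℝ, Tendsto (fun n : ℕ => c / (n : ℝ)) atTop (𝓝 0) := fun c =>
    tendsto_const_div_atTop_nhds_zero_nat c
  have hlim : Tendsto (fun n : ℕ => ((∑ k ∈ Finset.range n, g k) / n - (∑ k ∈ T, g k) / n)
      / (1 - (T.card : ℝ) / n)) atTop (𝓝 ((L - 0) / (1 - 0))) :=
    (h.sub (hc _)).div (tendsto_const_nhds.sub (hc _)) (by norm_num)
  have hlim' : Tendsto (fun n : ℕ => (∑ k ∈ Finset.range n \ T, g k)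
      / ((Finset.range n \ T).card : ℝ)) atTop (𝓝 L) := by
    rw [sub_zero, sub_zero, div_one] at hlim
    refine hlim.congr' ?_
    filter_upwards [hT, eventually_gt_atTop 0] with n hn hn0
    have hn0' : (n : ℝ) ≠ 0 := by positivity
    rw [← Finset.sum_sdiff hn (f := g), Finset.card_sdiff_of_subset hn, Finset.card_range,
      Nat.cast_sub (by simpa using Finset.card_le_card hn), ← sub_div, add_sub_cancel_right,
      one_sub_div hn0', div_div_div_cancel_right₀ hn0']
  have : Tendsto (fun n : ℕ => (∑ k ∈ Finset.range n \ T, (g k : EReal))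
      / (((Finset.range n \ T).card : ℝ) : EReal)) atTop (𝓝 (L : EReal)) := by
    refine ((continuous_coe_real_ereal.tendsto L).comp hlim').congr fun n => ?_
    rw [Function.comp_apply, EReal.coe_div, coe_sum_real]
  exact this.limsup_eq

variable {S : Type*}

open Classical in
/-- The sequence `c` takes the value `a` with limiting frequency `l a`, for every `a`. -/
def HasFreq (c : ℕ → S) (l : S → ℝ) : Prop :=
  ∀ a, Tendsto (fun n : ℕ => (∑ k ∈ Finset.range n, if c k = a then (1 : ℝ) else 0) / n) atTop
    (𝓝 (l a))

lemma HasFreq.tendsto_avg [Fintype S] {c : ℕ → S} {l : S → ℝ} (h : HasFreq c l) (φ : S → ℝ) :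
    Tendsto (fun n : ℕ => (∑ k ∈ Finset.range n, φ (c k)) / n) atTop (𝓝 (∑ a, l a * φ a)) := by
  classical
  have : Tendsto (fun n : ℕ => ∑ a, (∑ k ∈ Finset.range n, if c k = a then (1 : ℝ) else 0) / n
      * φ a) atTop (𝓝 (∑ a, l a * φ a)) := tendsto_finsetSum _ fun a _ => by
    convert (h a).mul_const (φ a)
  refine this.congr fun n => ?_
  simp_rw [div_mul_eq_mul_div, Finset.sum_mul]
  rw [← Finset.sum_div, Finset.sum_comm]
  congr 1
  refine Finset.sum_congr rfl fun k _ => ?_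
  simp

lemma HasFreq.frac_eq [Fintype S] {x : Play S} {l : S → ℝ}
    (h : HasFreq (fun k => repSignal k x) l) (T : Finset ℕ) (a : S) : frac T x a = l a := by
  classical
  unfold frac
  have := agentAvg_eq_of_tendsto T (h a)
  have e : (fun k => (((if repSignal k x = a then (1 : ℝ) else 0 : ℝ)) : EReal))
      = fun k => if repSignal k x = a then (1 : EReal) else 0 := by
    funext k
    split_ifs <;> simp
  rw [e] at this
  rw [← EReal.toReal_coe (l a), ← this]

open Classical in
lemma ncard_eq_sum_ite (p : ℕ → Prop) (n : ℕ) :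
    (({k ∈ Iio n | p k}.ncard : ℕ) : ℝ) = ∑ k ∈ Finset.range n, if p k then (1 : ℝ) else 0 := by
  have : {k ∈ Iio n | p k} = ((Finset.range n).filter p : Set ℕ) := by
    ext k
    simp
  rw [this, Set.ncard_coe_finset, Finset.sum_boole]

end Average

/-! ### Garblings of the state and posterior beliefs -/

section Garble

variable {S : Type*} [Fintype S]

/-- The distribution of a signal that is drawn from `w` and then passed through the channel `θ`. -/
def garble (θ : S → stdSimplex ℝ S) (w : stdSimplex ℝ S) : stdSimplex ℝ S :=
  ⟨fun a => ∑ b, w b * θ b a, by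
    refine ⟨fun a => Finset.sum_nonneg fun b _ => mul_nonneg (w.2.1 b) ((θ b).2.1 a), ?_⟩
    rw [Finset.sum_comm]
    have h1 : ∀ b, ∑ a, θ b a = 1 := fun b => (θ b).2.2
    have h2 : ∑ b, w b = 1 := w.2.2
    simp_rw [← Finset.mul_sum, h1, mul_one, h2]⟩

lemma garble_apply (θ : S → stdSimplex ℝ S) (w : stdSimplex ℝ S) (a : S) :
    garble θ w a = ∑ b, w b * θ b a := rfl

open Classical in
/-- The noiseless channel. -/
def idChannel (a : S) : stdSimplex ℝ S := stdSimplex.vertex a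

open Classical in
lemma idChannel_apply (a b : S) : idChannel a b = if b = a then 1 else 0 := by
  change (Pi.single a (1 : ℝ) : S → ℝ) b = _
  rw [Pi.single_apply]

lemma simplex_ext {w v : stdSimplex ℝ S} (h : ∀ a, w a = v a) : w = v := Subtype.ext (funext h)

lemma garble_idChannel (w : stdSimplex ℝ S) : garble idChannel w = w :=
  simplex_ext fun a => by
    classical
    simp [garble_apply, idChannel_apply]

lemma coord_nonneg (w : stdSimplex ℝ S) (a : S) : 0 ≤ w a := w.2.1 a

lemma sum_coord (w : stdSimplex ℝ S) : ∑ a, w a = 1 := w.2.2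

lemma coord_le_one (w : stdSimplex ℝ S) (a : S) : w a ≤ 1 :=
  sum_coord w ▸ Finset.single_le_sum (fun d _ => coord_nonneg w d) (Finset.mem_univ a)

lemma sum_ofReal_coord (w : stdSimplex ℝ S) : ∑ a, ENNReal.ofReal (w a) = 1 := by
  rw [← ENNReal.ofReal_sum_of_nonneg fun a _ => coord_nonneg w a, sum_coord, ENNReal.ofReal_one]

lemma measurable_garble_apply (θ : S → stdSimplex ℝ S) (a : S) :
    Measurable fun w : stdSimplex ℝ S => garble θ w a := by
  simp_rw [garble_apply]
  exact Finset.measurable_sum _ fun b _ => (measurable_coord b).mul_const _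

lemma measurable_garble (θ : S → stdSimplex ℝ S) : Measurable (garble θ) :=
  (measurable_pi_lambda _ fun a => measurable_garble_apply θ a).subtype_mk

lemma priorProb_nonneg (μ : Measure (stdSimplex ℝ S)) (b : S) : 0 ≤ priorProb μ b :=
  integral_nonneg fun w => coord_nonneg w b

variable (μ : Measure (stdSimplex ℝ S)) [IsProbabilityMeasure μ]

lemma integrable_coord (b : S) : Integrable (fun w : stdSimplex ℝ S => w b) μ :=
  Integrable.of_bound (measurable_coord b).aestronglyMeasurable 1
    (ae_of_all _ fun w => by
      rw [Real.norm_of_nonneg (coord_nonneg w b)]; exact coord_le_one w b)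

lemma integrable_mul_garble (θ : S → stdSimplex ℝ S) (a b : S) :
    Integrable (fun w : stdSimplex ℝ S => w b * garble θ w a) μ := by
  refine Integrable.of_bound
    ((measurable_coord b).mul (measurable_garble_apply θ a)).aestronglyMeasurable 1
    (ae_of_all _ fun w => ?_)
  rw [Real.norm_of_nonneg (mul_nonneg (coord_nonneg w b) (coord_nonneg _ a))]
  exact mul_le_one₀ (coord_le_one w b) (coord_nonneg _ a) (coord_le_one _ a)

lemma coord_eq_zero_of_priorProb {b : S} (h : priorProb μ b = 0) : ∀ᵐ w ∂μ, w b = 0 :=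
  (integral_eq_zero_iff_of_nonneg (fun w => coord_nonneg w b) (integrable_coord μ b)).1 h

lemma priorProb_mul_posterior (b c : S) :
    priorProb μ b * posterior μ b c = pairProb μ b c := by
  by_cases h : priorProb μ b = 0
  · rw [h, zero_mul]
    refine (integral_eq_zero_of_ae ?_).symm
    filter_upwards [coord_eq_zero_of_priorProb μ h] with w hw
    simp [hw]
  · have : posterior μ b c = pairProb μ b c / priorProb μ b := by
      unfold posterior
      rw [dif_neg h]
      rfl
    rw [this, mul_div_cancel₀ _ h]

/-- The posterior belief about a garbled signal is the garbled posterior belief. -/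
lemma priorProb_mul_garble_posterior (θ : S → stdSimplex ℝ S) (a b : S) :
    priorProb μ b * garble θ (posterior μ b) a = ∫ w, w b * garble θ w a ∂μ := by
  simp_rw [garble_apply, Finset.mul_sum, ← mul_assoc]
  rw [integral_finsetSum _ fun c _ => (integrable_pair μ b c).mul_const _]
  refine Finset.sum_congr rfl fun c _ => ?_
  rw [priorProb_mul_posterior, integral_mul_const]
  rfl

lemma ae_priorProb_pos : ∀ᵐ w ∂μ, ∀ b, 0 < w b → 0 < priorProb μ b := by
  rw [ae_all_iff]
  intro b
  rcases (priorProb_nonneg μ b).eq_or_lt with h | h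
  · filter_upwards [coord_eq_zero_of_priorProb μ h.symm] with w hw hpos
    exact absurd hw hpos.ne'
  · exact ae_of_all _ fun w _ => h

/-- An agent with posterior beliefs does not rule out anything that happens. -/
lemma ae_garble_posterior_pos (θ : S → stdSimplex ℝ S) :
    ∀ᵐ w ∂μ, ∀ a b, 0 < w b → 0 < garble θ w a → 0 < garble θ (posterior μ b) a := by
  rw [ae_all_iff]
  intro a
  rw [ae_all_iff]
  intro b
  rcases (coord_nonneg (garble θ (posterior μ b)) a).eq_or_lt with h | h
  · have h0 := priorProb_mul_garble_posterior μ θ a b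
    rw [← h, mul_zero] at h0
    have := (integral_eq_zero_iff_of_nonneg
      (fun w => mul_nonneg (coord_nonneg w b) (coord_nonneg _ a))
      (integrable_mul_garble μ θ a b)).1 h0.symm
    filter_upwards [this] with w hw h1 h2
    exact absurd hw (mul_pos h1 h2).ne'
  · exact ae_of_all _ fun w _ _ => h

variable {μ}

lemma PosteriorSupported.ae_coord_pos (h : PosteriorSupported μ) :
    ∀ᵐ w ∂μ, ∀ b c, 0 < w b → 0 < posterior μ b c → 0 < w c := by
  filter_upwards [h, ae_priorProb_pos μ] with w hw hq b c hb hc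
  refine hw b c hb ?_
  rw [← priorProb_mul_posterior]
  exact mul_pos (hq b hb) hc

lemma PosteriorSupported.ae_garble_pos (h : PosteriorSupported μ) (θ : S → stdSimplex ℝ S) :
    ∀ᵐ w ∂μ, ∀ b a, 0 < w b → 0 < garble θ (posterior μ b) a → 0 < garble θ w a := by
  filter_upwards [h.ae_coord_pos] with w hw b a hb ha
  rw [garble_apply] at ha
  obtain ⟨c, -, hc⟩ := Finset.exists_lt_of_sum_lt (s := Finset.univ) (f := fun _ : S => (0 : ℝ))
    (by simpa using ha)
  have hq : 0 < posterior μ b c := pos_of_mul_pos_left hc (coord_nonneg _ _)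
  have ht : 0 < θ c a := pos_of_mul_pos_right hc (coord_nonneg _ _)
  rw [garble_apply]
  exact (mul_pos (hw b c hb hq) ht).trans_le (Finset.single_le_sum
    (f := fun c => w c * θ c a) (fun c _ => mul_nonneg (coord_nonneg _ _) (coord_nonneg _ _))
    (Finset.mem_univ c))

end Garble

/-! ### The average information score as a function of the state -/

section Score

variable {S : Type*} [Fintype S] (μ : Measure (stdSimplex ℝ S)) [IsProbabilityMeasure μ]
  (f : ℝ → ℝ) (θ : S → stdSimplex ℝ S)

/-- The ratio between the posterior probability, given the signal `b`, of the garbled signal `a` and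
its actual frequency in the state `w`. Where that frequency vanishes the value is immaterial, since
the ratio is always weighted by the frequency. -/
def ratio (b : S) (w : stdSimplex ℝ S) (a : S) : ℝ :=
  garble θ (posterior μ b) a / garble θ w a

/-- The average information score in the state `w` if the reported signals are garbled by `θ` and
all predictions are correct posteriors. -/
def avgScore (w : stdSimplex ℝ S) : ℝ :=
  ∑ a, ∑ b, garble θ w a * w b * f (ratio μ θ b w a)

/-- The positive part of the summands of the average information score; the negative part is
obtained by replacing `f` with `-f`. -/
def posScore (w : stdSimplex ℝ S) : ℝ≥0∞ :=
  ∑ a, ∑ b, ENNReal.ofReal (garble θ w a) * ENNReal.ofReal (w b)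
    * ENNReal.ofReal (f (ratio μ θ b w a))

/-- The expected average information score for garbled reports and correct posteriors. -/
def garbledInfo : EReal :=
  ((∫⁻ w, posScore μ f θ w ∂μ : ℝ≥0∞) : EReal) - ((∫⁻ w, posScore μ (-f) θ w ∂μ : ℝ≥0∞) : EReal)

lemma coe_sum_mul_eq_sub {ι : Type*} (T : Finset ι) {c y : ι → ℝ} (hc : ∀ i ∈ T, 0 ≤ c i) :
    ((∑ i ∈ T, c i * y i : ℝ) : EReal)
      = ((∑ i ∈ T, ENNReal.ofReal (c i) * ENNReal.ofReal (y i) : ℝ≥0∞) : EReal)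
        - ((∑ i ∈ T, ENNReal.ofReal (c i) * ENNReal.ofReal (-y i) : ℝ≥0∞) : EReal) := by
  have key : ∀ z : ι → ℝ, ((∑ i ∈ T, ENNReal.ofReal (c i) * ENNReal.ofReal (z i) : ℝ≥0∞) : EReal)
      = ((∑ i ∈ T, c i * max (z i) 0 : ℝ) : EReal) := fun z => by
    have hz : ∀ i ∈ T, 0 ≤ c i * max (z i) 0 := fun i hi =>
      mul_nonneg (hc i hi) (le_max_right _ _)
    have e : ∑ i ∈ T, ENNReal.ofReal (c i) * ENNReal.ofReal (z i)
        = ENNReal.ofReal (∑ i ∈ T, c i * max (z i) 0) := by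
      rw [ENNReal.ofReal_sum_of_nonneg hz]
      refine Finset.sum_congr rfl fun i hi => ?_
      rw [ENNReal.ofReal_mul (hc i hi)]
      congr 1
      simp [ENNReal.ofReal, Real.toNNReal]
    rw [e, EReal.coe_ennreal_ofReal, max_eq_left (Finset.sum_nonneg hz)]
  rw [key, key, ← EReal.coe_sub, ← Finset.sum_sub_distrib]
  congr 1
  refine Finset.sum_congr rfl fun i _ => ?_
  rw [← mul_sub]
  congr 1
  rcases le_total 0 (y i) with h | h
  · rw [max_eq_left h, max_eq_right (by linarith), sub_zero]
  · rw [max_eq_right h, max_eq_left (by linarith)]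
    ring

lemma coe_avgScore (w : stdSimplex ℝ S) :
    ((avgScore μ f θ w : ℝ) : EReal)
      = (posScore μ f θ w : EReal) - (posScore μ (-f) θ w : EReal) := by
  have := coe_sum_mul_eq_sub (Finset.univ : Finset (S × S))
    (c := fun p => garble θ w p.1 * w p.2) (y := fun p => f (ratio μ θ p.2 w p.1))
    fun p _ => mul_nonneg (coord_nonneg _ _) (coord_nonneg _ _)
  simp only [Fintype.sum_prod_type, ENNReal.ofReal_mul (coord_nonneg _ _)] at this
  exact this

lemma ratio_nonneg (b : S) (w : stdSimplex ℝ S) (a : S) : 0 ≤ ratio μ θ b w a :=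
  div_nonneg (coord_nonneg _ _) (coord_nonneg _ _)

lemma measurable_ratio (b a : S) : Measurable fun w => ratio μ θ b w a :=
  measurable_const.div (measurable_garble_apply θ a)

variable {f}

lemma measurable_comp_ratio (hf : ConvexOn ℝ (Ioi 0) f) (b a : S) :
    Measurable fun w => f (ratio μ θ b w a) :=
  measurable_comp_of_nonneg hf (measurable_ratio μ θ b a) fun w => ratio_nonneg μ θ b w a

lemma measurable_posScore {g : ℝ → ℝ} (hg : ∀ b a, Measurable fun w => g (ratio μ θ b w a)) :
    Measurable (posScore μ g θ) := by
  unfold posScore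
  exact Finset.measurable_sum _ fun a _ => Finset.measurable_sum _ fun b _ =>
    (((measurable_garble_apply θ a).ennreal_ofReal.mul (measurable_coord b).ennreal_ofReal).mul
      (hg b a).ennreal_ofReal)

lemma measurable_posScore_pos (hf : ConvexOn ℝ (Ioi 0) f) : Measurable (posScore μ f θ) :=
  measurable_posScore μ θ fun b a => measurable_comp_ratio μ θ hf b a

lemma measurable_posScore_neg (hf : ConvexOn ℝ (Ioi 0) f) : Measurable (posScore μ (-f) θ) :=
  measurable_posScore μ θ fun b a => (measurable_comp_ratio μ θ hf b a).neg

/-- A convex function is bounded below by an affine function, and the weighted ratios are bounded,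
so the negative parts are bounded. -/
lemma lintegral_posScore_neg_ne_top (hf : ConvexOn ℝ (Ioi 0) f) :
    ∫⁻ w, posScore μ (-f) θ w ∂μ ≠ ⊤ := by
  obtain ⟨C, hC, hle⟩ := exists_neg_le_of_convexOn hf
  have hb : ∀ᵐ w ∂μ, posScore μ (-f) θ w ≤ ∑ _a : S, ∑ _b : S, ENNReal.ofReal (2 * C) := by
    filter_upwards [ae_garble_posterior_pos μ θ] with w hw
    refine Finset.sum_le_sum fun a _ => Finset.sum_le_sum fun b _ => ?_
    rw [← ENNReal.ofReal_mul (coord_nonneg _ _),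
      ← ENNReal.ofReal_mul (mul_nonneg (coord_nonneg _ _) (coord_nonneg _ _))]
    refine ENNReal.ofReal_le_ofReal ?_
    rcases (coord_nonneg w b).eq_or_lt with h0 | h0
    · rw [← h0]
      simp [hC]
    rcases (coord_nonneg (garble θ w) a).eq_or_lt with h1 | h1
    · rw [← h1]
      simp [hC]
    have hm := hw a b h0 h1
    have hr : 0 < ratio μ θ b w a := div_pos hm h1
    have e : garble θ w a * (1 + ratio μ θ b w a)
        = garble θ w a + garble θ (posterior μ b) a := by
      unfold ratio
      field_simp
    have l1 := coord_le_one (garble θ w) a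
    have l2 := coord_le_one (garble θ (posterior μ b)) a
    calc garble θ w a * w b * (-f) (ratio μ θ b w a)
        ≤ garble θ w a * w b * (C * (1 + ratio μ θ b w a)) :=
          mul_le_mul_of_nonneg_left (hle _ hr) (mul_pos h1 h0).le
      _ = w b * (C * (garble θ w a + garble θ (posterior μ b) a)) := by rw [← e]; ring
      _ ≤ 1 * (C * (garble θ w a + garble θ (posterior μ b) a)) :=
          mul_le_mul_of_nonneg_right (coord_le_one w b) (by positivity)
      _ ≤ 2 * C := by nlinarith
  refine ne_top_of_le_ne_top ?_ (lintegral_mono_ae hb)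
  rw [lintegral_const, measure_univ, mul_one]
  exact (ENNReal.sum_lt_top.2 fun _ _ =>
    ENNReal.sum_lt_top.2 fun _ _ => ENNReal.ofReal_lt_top).ne

lemma expect_avgScore (hf : ConvexOn ℝ (Ioi 0) f) :
    expect μ (fun w => ((avgScore μ f θ w : ℝ) : EReal)) = garbledInfo μ f θ := by
  simp_rw [coe_avgScore]
  exact expect_sub (measurable_posScore_pos μ θ hf).aemeasurable
    (measurable_posScore_neg μ θ hf).aemeasurable (lintegral_posScore_neg_ne_top μ θ hf)

/-- Garbling the reports cannot increase the average information score, in almost every state: this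
is Jensen's inequality for the perspective of `f`. -/
lemma ae_avgScore_le (hf : ConvexOn ℝ (Ioi 0) f)
    (hreg : Tendsto (fun t => f t / t) atTop (𝓝 0) ∨ PosteriorSupported μ) :
    ∀ᵐ w ∂μ, avgScore μ f θ w ≤ avgScore μ f idChannel w := by
  have hreg' : ∀ᵐ w ∂μ, AntitoneOn f (Ioi 0) ∨
      ∀ b c, 0 < w b → 0 < posterior μ b c → 0 < w c := by
    rcases hreg with h | h
    · exact ae_of_all _ fun w => Or.inl (antitoneOn_of_tendsto_div hf h)
    · exact h.ae_coord_pos.mono fun w hw => Or.inr hw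
  filter_upwards [hreg', ae_garble_posterior_pos μ idChannel] with w hw hpos
  simp only [garble_idChannel] at hpos
  unfold avgScore ratio
  simp only [garble_idChannel]
  refine (le_of_eq Finset.sum_comm).trans
    ((Finset.sum_le_sum fun b _ => ?_).trans (le_of_eq Finset.sum_comm))
  have key : ∀ a, garble θ w a * w b * f (garble θ (posterior μ b) a / garble θ w a)
      ≤ ∑ c, θ c a * (w c * w b * f (posterior μ b c / w c)) := by
    intro a
    rcases (coord_nonneg w b).eq_or_lt with h0 | h0
    · simp [← h0]
    have hJ := perspective_sum_le Finset.univ hf (x := fun c => w c * θ c a)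
      (y := fun c => posterior μ b c * θ c a)
      (fun c _ => mul_nonneg (coord_nonneg _ _) (coord_nonneg _ _))
      (fun c _ => mul_nonneg (coord_nonneg _ _) (coord_nonneg _ _))
      (fun c _ hc => mul_pos (hpos c b h0 (pos_of_mul_pos_left hc (coord_nonneg _ _)))
        (pos_of_mul_pos_right hc (coord_nonneg _ _)))
      (by
        refine hw.imp_right fun h c _ hc => ?_
        rcases mul_eq_zero.1 hc with hc | hc
        · have : ¬ 0 < posterior μ b c := fun hq => (h b c h0 hq).ne' hc
          rw [le_antisymm (not_lt.1 this) (coord_nonneg _ _), zero_mul]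
        · rw [hc, mul_zero])
    calc garble θ w a * w b * f (garble θ (posterior μ b) a / garble θ w a)
        = w b * (garble θ w a * f (garble θ (posterior μ b) a / garble θ w a)) := by ring
      _ ≤ w b * ∑ c, w c * θ c a * f (posterior μ b c * θ c a / (w c * θ c a)) :=
          mul_le_mul_of_nonneg_left hJ h0.le
      _ = ∑ c, θ c a * (w c * w b * f (posterior μ b c / w c)) := by
          rw [Finset.mul_sum]
          refine Finset.sum_congr rfl fun c _ => ?_
          by_cases ht : θ c a = 0
          · simp [ht]
          · rw [mul_div_mul_right _ _ ht]
            ring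
  calc ∑ a, garble θ w a * w b * f (garble θ (posterior μ b) a / garble θ w a)
      ≤ ∑ a, ∑ c, θ c a * (w c * w b * f (posterior μ b c / w c)) :=
        Finset.sum_le_sum fun a _ => key a
    _ = ∑ c, w c * w b * f (posterior μ b c / w c) := by
        rw [Finset.sum_comm]
        refine Finset.sum_congr rfl fun c _ => ?_
        rw [← Finset.sum_mul, sum_coord, one_mul]

lemma garbledInfo_le (hf : ConvexOn ℝ (Ioi 0) f)
    (hreg : Tendsto (fun t => f t / t) atTop (𝓝 0) ∨ PosteriorSupported μ) :
    garbledInfo μ f θ ≤ garbledInfo μ f idChannel := by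
  rw [← expect_avgScore μ θ hf, ← expect_avgScore μ idChannel hf]
  exact expect_mono ((ae_avgScore_le μ θ hf hreg).mono fun w hw => EReal.coe_le_coe_iff.2 hw)

end Score

/-! ### Conditional mutual information of the state and a garbled signal -/

section MutualInformation

lemma sum_coe_sub_coe {ι : Type*} (T : Finset ι) (u v : ι → ℝ≥0∞) (hv : ∀ i ∈ T, v i ≠ ⊤) :
    ∑ i ∈ T, ((u i : EReal) - (v i : EReal))
      = ((∑ i ∈ T, u i : ℝ≥0∞) : EReal) - ((∑ i ∈ T, v i : ℝ≥0∞) : EReal) := by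
  classical
  induction T using Finset.induction_on with
  | empty => simp
  | insert i T hi ih =>
    have h1 : v i ≠ ⊤ := hv i (Finset.mem_insert_self _ _)
    rw [Finset.sum_insert hi, Finset.sum_insert hi, Finset.sum_insert hi,
      ih fun j hj => hv j (Finset.mem_insert_of_mem hj), EReal.coe_ennreal_add,
      EReal.coe_ennreal_add, EReal.add_sub_add_comm (Or.inl (EReal.coe_ennreal_ne_bot _))
        (Or.inl (mt EReal.coe_ennreal_eq_top_iff.1 h1))]

variable {S : Type*} [Fintype S] [MeasurableSpace S] [DiscreteMeasurableSpace S]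
  {μ : Measure (stdSimplex ℝ S)} [IsProbabilityMeasure μ] {θ : S → stdSimplex ℝ S}
  {α : Type*} [MeasurableSpace α] {X₀ : stdSimplex ℝ S → α} {G : α → S → ℝ≥0∞}

/-- Let `U` be the law of `(X₀, Y)` given the signal `z`, where `Y` is a signal garbled by `θ` and
the conditional law of `Y` given the state is the function `G` of `X₀`. The density of the product
of the marginals with respect to `U` is the posterior of `Y` given `z` divided by `G`, and the
singular part sits on the zero set of `G`. -/
lemma fMI_eq_of_lintegral {f : ℝ → ℝ} (hf : ConvexOn ℝ (Ioi 0) f)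
    (hGm : ∀ a, Measurable fun x => G x a)
    (hG : ∀ w a, G (X₀ w) a = ENNReal.ofReal (garble θ w a))
    (hslope : slopeAtTop f = 0 ∨
      ∀ᵐ w ∂μ, ∀ b a, 0 < w b → 0 < garble θ (posterior μ b) a → 0 < garble θ w a)
    {z : S} (hz : 0 < priorProb μ z) {U : Measure (α × S)} [IsProbabilityMeasure U]
    (hU : ∀ H : α × S → ℝ≥0∞, Measurable H → ∫⁻ p, H p ∂U
      = (ENNReal.ofReal (priorProb μ z))⁻¹ * ∫⁻ w, ∑ a, ENNReal.ofReal (garble θ w a)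
        * ENNReal.ofReal (w z) * H (X₀ w, a) ∂μ) :
    fMI f U = (((ENNReal.ofReal (priorProb μ z))⁻¹ * ∫⁻ w, ∑ a, ENNReal.ofReal (garble θ w a)
        * ENNReal.ofReal (w z) * ENNReal.ofReal (f (ratio μ θ z w a)) ∂μ : ℝ≥0∞) : EReal)
      - (((ENNReal.ofReal (priorProb μ z))⁻¹ * ∫⁻ w, ∑ a, ENNReal.ofReal (garble θ w a)
        * ENNReal.ofReal (w z) * ENNReal.ofReal (-f (ratio μ θ z w a)) ∂μ : ℝ≥0∞) : EReal) := by
  set q := ENNReal.ofReal (priorProb μ z) with hq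
  have hq0 : q ≠ 0 := by simpa [hq] using hz
  set m : S → ℝ≥0∞ := fun a => ENNReal.ofReal (garble θ (posterior μ z) a) with hm
  have hfst : ∀ h : α → ℝ≥0∞, Measurable h → ∫⁻ x, h x ∂U.fst
      = q⁻¹ * ∫⁻ w, ENNReal.ofReal (w z) * h (X₀ w) ∂μ := by
    intro h hh
    rw [Measure.fst, lintegral_map hh measurable_fst, hU (fun p => h p.1) (hh.comp measurable_fst)]
    congr 1
    refine lintegral_congr fun w => ?_
    dsimp only
    rw [← Finset.sum_mul, ← Finset.sum_mul, sum_ofReal_coord, one_mul]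
  have hsnd : ∀ a, U.snd {a} = m a := by
    intro a
    rw [← lintegral_indicator_one (measurableSet_singleton a), Measure.snd,
      lintegral_map (measurable_one.indicator (measurableSet_singleton a)) measurable_snd,
      hU (fun p => ({a} : Set S).indicator 1 p.2) ((measurable_one.indicator (measurableSet_singleton a)).comp measurable_snd)]
    have e : ∀ w : stdSimplex ℝ S, ∑ c, ENNReal.ofReal (garble θ w c) * ENNReal.ofReal (w z)
        * ({a} : Set S).indicator (1 : S → ℝ≥0∞) c
        = ENNReal.ofReal (w z * garble θ w a) := fun w => by
      rw [Finset.sum_eq_single a (fun c _ hc => by simp [hc]) (by simp)]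
      simp [ENNReal.ofReal_mul (coord_nonneg w z), mul_comm]
    change q⁻¹ * ∫⁻ w : stdSimplex ℝ S, ∑ c, ENNReal.ofReal (garble θ w c) * ENNReal.ofReal (w z)
        * ({a} : Set S).indicator (1 : S → ℝ≥0∞) c ∂μ = m a
    simp_rw [e]
    rw [← ofReal_integral_eq_lintegral_ofReal (integrable_mul_garble μ θ a z)
      (ae_of_all _ fun w => mul_nonneg (coord_nonneg _ _) (coord_nonneg _ _)),
      ← priorProb_mul_garble_posterior, ENNReal.ofReal_mul (priorProb_nonneg μ z), ← hq,
      ← mul_assoc, ENNReal.inv_mul_cancel hq0 ENNReal.ofReal_ne_top, one_mul]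
  set V := U.fst.prod U.snd with hV
  have hVint : ∀ H : α × S → ℝ≥0∞, Measurable H → ∫⁻ p, H p ∂V
      = q⁻¹ * ∫⁻ w, ENNReal.ofReal (w z) * ∑ a, H (X₀ w, a) * m a ∂μ := by
    intro H hH
    rw [hV, lintegral_prod _ hH.aemeasurable]
    simp_rw [lintegral_fintype, hsnd]
    exact hfst _ (Finset.measurable_sum _ fun a _ => (hH.comp (by fun_prop)).mul_const _)
  have hGm' : Measurable fun p : α × S => G p.1 p.2 :=
    measurable_from_prod_countable_left fun a => hGm a
  set r : α × S → ℝ≥0∞ := fun p => m p.2 / G p.1 p.2 with hr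
  have hrm : Measurable r := ((measurable_of_finite m).comp measurable_snd).div hGm'
  set A : Set (α × S) := {p | G p.1 p.2 = 0} with hA
  have hAm : MeasurableSet A := hGm' (measurableSet_singleton 0)
  have hmem : ∀ w a, (X₀ w, a) ∈ A ↔ ENNReal.ofReal (garble θ w a) = 0 := fun w a => by
    rw [← hG]; rfl
  have hsing : V.restrict A ⟂ₘ U := by
    refine ⟨Aᶜ, hAm.compl, by simp [Measure.restrict_apply hAm.compl], ?_⟩
    rw [compl_compl, ← lintegral_indicator_one hAm,
      hU _ (measurable_one.indicator hAm)]
    refine mul_eq_zero_of_right _ (lintegral_eq_zero_of_ae_eq_zero (ae_of_all _ fun w => ?_))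
    refine Finset.sum_eq_zero fun a _ => ?_
    by_cases ha : (X₀ w, a) ∈ A
    · rw [(hmem w a).1 ha, zero_mul, zero_mul]
    · rw [indicator_of_notMem ha, mul_zero]
  -- The Lebesgue decomposition of the product of the marginals with respect to the joint law.
  have hdec : V = V.restrict A + U.withDensity r := by
    conv_lhs => rw [← Measure.restrict_add_restrict_compl hAm (μ := V)]
    congr 1
    refine Measure.ext_of_lintegral _ fun H hH => ?_
    rw [lintegral_withDensity_eq_lintegral_mul _ hrm hH, ← lintegral_indicator hAm.compl,
      hVint _ (hH.indicator hAm.compl), hU _ (hrm.mul hH)]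
    congr 1
    refine lintegral_congr fun w => ?_
    rw [Finset.mul_sum]
    refine Finset.sum_congr rfl fun a _ => ?_
    by_cases ha : (X₀ w, a) ∈ A
    · rw [indicator_of_notMem (by simpa using ha), (hmem w a).1 ha]
      simp
    · rw [indicator_of_mem (by simpa using ha)]
      rw [hmem] at ha
      simp only [hr, Pi.mul_apply, hG]
      rw [show ∀ g y p h : ℝ≥0∞, g * y * (p / g * h) = y * (h * (g * (p / g))) from
        fun g y p h => by ring, ENNReal.mul_div_cancel ha ENNReal.ofReal_ne_top]
  have hrn : r =ᵐ[U] V.rnDeriv U := Measure.eq_rnDeriv hrm hsing hdec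
  have hsp : V.restrict A = V.singularPart U := Measure.eq_singularPart hrm hsing hdec
  -- The singular part carries no mass in almost every state, unless its coefficient is zero.
  have hzero : slopeAtTop f * ((V.singularPart U univ : ℝ≥0∞) : EReal) = 0 := by
    rcases hslope with h | h
    · rw [h, zero_mul]
    · have : V.singularPart U univ = 0 := by
        rw [← hsp, Measure.restrict_apply_univ, ← lintegral_indicator_one hAm,
          hVint _ (measurable_one.indicator hAm)]
        refine mul_eq_zero_of_right _ (lintegral_eq_zero_of_ae_eq_zero ?_)
        filter_upwards [h] with w hw
        rw [Pi.zero_apply, Finset.mul_sum]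
        refine Finset.sum_eq_zero fun a _ => ?_
        by_cases ha : (X₀ w, a) ∈ A
        · rw [hmem, ENNReal.ofReal_eq_zero] at ha
          by_cases hwz : 0 < w z
          · have : ¬ 0 < garble θ (posterior μ z) a := fun h0 => (hw z a hwz h0).not_ge ha
            rw [hm]
            simp [not_lt.1 this]
          · simp [not_lt.1 hwz]
        · rw [indicator_of_notMem ha]
          simp
      rw [this]
      simp
  have hrr : ∀ w a, (r (X₀ w, a)).toReal = ratio μ θ z w a := fun w a => by
    rw [hr]
    simp only [hG, hm]
    rw [ENNReal.toReal_div, ENNReal.toReal_ofReal (coord_nonneg _ _),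
      ENNReal.toReal_ofReal (coord_nonneg _ _)]
    rfl
  have hfr : Measurable fun p => f (r p).toReal :=
    measurable_comp_of_nonneg hf hrm.ennreal_toReal fun p => ENNReal.toReal_nonneg
  have hsplit : ∀ y : ℝ, (y : EReal)
      = ((ENNReal.ofReal y : ℝ≥0∞) : EReal) - ((ENNReal.ofReal (-y) : ℝ≥0∞) : EReal) := fun y =>
    (toENNReal_sub_toENNReal_neg (y : EReal)).symm
  have hfin : ∫⁻ w, ∑ a, ENNReal.ofReal (garble θ w a)
      * ENNReal.ofReal (w z) * ENNReal.ofReal (-f (ratio μ θ z w a)) ∂μ ≠ ⊤ := by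
    refine ne_top_of_le_ne_top (lintegral_posScore_neg_ne_top μ θ hf) (lintegral_mono fun w => ?_)
    exact Finset.sum_le_sum fun a _ => Finset.single_le_sum
      (f := fun b => ENNReal.ofReal (garble θ w a) * ENNReal.ofReal (w b)
        * ENNReal.ofReal (-f (ratio μ θ b w a))) (fun _ _ => zero_le) (Finset.mem_univ z)
  have hfr' : Measurable fun p => -f (r p).toReal := hfr.neg
  have e1 := hU _ hfr.ennreal_ofReal
  have e2 := hU _ hfr'.ennreal_ofReal
  simp only [hrr] at e1 e2
  rw [fMI, fDiv, ← hV, hzero, add_zero,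
    expect_congr (g' := fun p => ((f (r p).toReal : ℝ) : EReal))
      (hrn.mono fun p hp => by simp only [hp])]
  simp_rw [fun p => hsplit (f (r p).toReal)]
  rw [expect_sub hfr.ennreal_ofReal.aemeasurable hfr'.ennreal_ofReal.aemeasurable, e1, e2]
  rw [e2]
  exact ENNReal.mul_ne_top (ENNReal.inv_ne_top.2 hq0) hfin

lemma condFMI_eq_garbledInfo {f : ℝ → ℝ} (hf : ConvexOn ℝ (Ioi 0) f)
    (hGm : ∀ a, Measurable fun x => G x a)
    (hG : ∀ w a, G (X₀ w) a = ENNReal.ofReal (garble θ w a))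
    (hslope : slopeAtTop f = 0 ∨
      ∀ᵐ w ∂μ, ∀ b a, 0 < w b → 0 < garble θ (posterior μ b) a → 0 < garble θ w a)
    {Ω : Type*} [MeasurableSpace Ω] {P : Measure Ω} {X : Ω → α} {Y Z : Ω → S}
    (hX : Measurable X) (hY : Measurable Y) (hZ : Measurable Z)
    (hP : ∀ F : α → S → S → ℝ≥0∞, (∀ a b, Measurable fun x => F x a b) →
      ∫⁻ x, F (X x) (Y x) (Z x) ∂P = ∫⁻ w, ∑ a, ∑ b, ENNReal.ofReal (garble θ w a)
        * ENNReal.ofReal (w b) * F (X₀ w) a b ∂μ) :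
    condFMI f P X Y Z = garbledInfo μ f θ := by
  classical
  have hres : ∀ z (H : α × S → ℝ≥0∞), Measurable H →
      ∫⁻ x in Z ⁻¹' {z}, H (X x, Y x) ∂P
        = ∫⁻ w, ∑ a, ENNReal.ofReal (garble θ w a) * ENNReal.ofReal (w z) * H (X₀ w, a) ∂μ := by
    intro z H hH
    have h1 := hP (fun x a b => if b = z then H (x, a) else 0) fun a b => by
      split_ifs
      · exact hH.comp (by fun_prop)
      · exact measurable_const
    rw [← lintegral_indicator (hZ (measurableSet_singleton z))]
    refine Eq.trans (lintegral_congr fun x => ?_) (h1.trans (lintegral_congr fun w => ?_))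
    · by_cases h : Z x = z
      · rw [indicator_of_mem (by simpa using h), if_pos h]
      · rw [indicator_of_notMem (by simpa using h), if_neg h]
    · simp
  have hPz : ∀ z, P (Z ⁻¹' {z}) = ENNReal.ofReal (priorProb μ z) := by
    intro z
    have := hres z (fun _ => 1) measurable_const
    simp only [lintegral_const, one_mul, Measure.restrict_apply_univ, mul_one] at this
    rw [this, priorProb, ofReal_integral_eq_lintegral_ofReal (integrable_coord μ z)
      (ae_of_all _ fun w => coord_nonneg w z)]
    refine lintegral_congr fun w => ?_
    rw [← Finset.sum_mul, sum_ofReal_coord, one_mul]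
  set J : (ℝ → ℝ) → S → ℝ≥0∞ := fun g z => ∫⁻ w, ∑ a, ENNReal.ofReal (garble θ w a)
    * ENNReal.ofReal (w z) * ENNReal.ofReal (g (ratio μ θ z w a)) ∂μ with hJ
  have hsumJ : ∀ g : ℝ → ℝ, (∀ b a, Measurable fun w => g (ratio μ θ b w a)) →
      ∑ z, J g z = ∫⁻ w, posScore μ g θ w ∂μ := by
    intro g hg
    rw [hJ, ← lintegral_finsetSum]
    · refine lintegral_congr fun w => ?_
      rw [Finset.sum_comm]
      rfl
    · intro z _
      exact Finset.measurable_sum _ fun a _ =>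
        (((measurable_garble_apply θ a).ennreal_ofReal.mul
          (measurable_coord z).ennreal_ofReal).mul (hg z a).ennreal_ofReal)
  have hneg := hsumJ (-f) fun b a => (measurable_comp_ratio μ θ hf b a).neg
  have hJfin : ∀ z ∈ (Finset.univ : Finset S), J (-f) z ≠ ⊤ := fun z hz =>
    ne_top_of_le_ne_top (hneg ▸ lintegral_posScore_neg_ne_top μ θ hf)
      (Finset.single_le_sum (fun _ _ => zero_le) hz)
  rw [garbledInfo, ← hsumJ f fun b a => measurable_comp_ratio μ θ hf b a, ← hneg,
    ← sum_coe_sub_coe _ _ _ hJfin]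
  unfold condFMI
  refine Finset.sum_congr rfl fun z _ => ?_
  rw [hPz]
  rcases (priorProb_nonneg μ z).eq_or_lt with hz | hz
  · have hJ0 : ∀ g, J g z = 0 := fun g => by
      refine lintegral_eq_zero_of_ae_eq_zero ?_
      filter_upwards [coord_eq_zero_of_priorProb μ hz.symm] with w hw
      simp [hw]
    rw [hJ0, hJ0, ← hz]
    simp
  set q := ENNReal.ofReal (priorProb μ z) with hq
  have hq0 : q ≠ 0 := by simpa [hq] using hz
  have hqt : q ≠ ⊤ := ENNReal.ofReal_ne_top
  have : IsProbabilityMeasure (P[|Z ⁻¹' {z}]) :=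
    cond_isProbabilityMeasure_of_finite (by rw [hPz]; exact hq0) (by rw [hPz]; exact hqt)
  have : IsProbabilityMeasure (Measure.map (fun x => (X x, Y x)) (P[|Z ⁻¹' {z}])) :=
    Measure.isProbabilityMeasure_map (hX.prodMk hY).aemeasurable
  rw [fMI_eq_of_lintegral hf hGm hG hslope hz]
  · rw [EReal.mul_sub_of_nonneg_of_ne_top (EReal.coe_ennreal_nonneg _)
      (mt EReal.coe_ennreal_eq_top_iff.1 hqt), ← EReal.coe_ennreal_mul, ← EReal.coe_ennreal_mul,
      ← mul_assoc, ← mul_assoc, ENNReal.mul_inv_cancel hq0 hqt, one_mul, one_mul]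
    rfl
  · intro H hH
    rw [lintegral_map hH (hX.prodMk hY), ProbabilityTheory.cond, lintegral_smul_measure, hPz,
      hres z H hH, smul_eq_mul]

end MutualInformation

/-! ### The law of a play -/

lemma hasFreq_iff {S : Type*} {Ω : Type*} {c : ℕ → Ω → S} {l : S → ℝ} {x : Ω} :
    HasFreq (fun k => c k x) l ↔ ∀ a, Tendsto (fun n : ℕ =>
      (∑ k ∈ Finset.range n, Set.indicator {y | c k y = a} (fun _ => (1 : ℝ)) x) / n) atTop
      (𝓝 (l a)) := by
  classical
  simp only [HasFreq, Set.indicator_apply, mem_ofPred_eq]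

section Law

variable {S : Type*} [Fintype S] [MeasurableSpace S]

/-- The joint law of the agents' signals and reports, given the state of the world. -/
abbrev agentsLaw (s : ℕ → Strategy S) (w : stdSimplex ℝ S) : Measure (ℕ → S × Report S) :=
  Measure.infinitePi fun i => agentLaw w (s i)

lemma lintegral_playLaw (μ : Measure (stdSimplex ℝ S)) (s : ℕ → Strategy S) {H : Play S → ℝ≥0∞}
    (hH : Measurable H) :
    ∫⁻ x, H x ∂playLaw μ s = ∫⁻ w, ∫⁻ y, H (w, y) ∂agentsLaw s w ∂μ := by
  rw [playLaw, Measure.lintegral_bind (measurable_lawGiven s).aemeasurable hH.aemeasurable]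
  refine lintegral_congr fun w => ?_
  rw [lawGiven, lintegral_map hH measurable_prodMk_left]

lemma ae_playLaw {μ : Measure (stdSimplex ℝ S)} {s : ℕ → Strategy S} {p : Play S → Prop}
    (hp : MeasurableSet {x | p x}) (h : ∀ᵐ w ∂μ, ∀ᵐ y ∂agentsLaw s w, p (w, y)) :
    ∀ᵐ x ∂playLaw μ s, p x := by
  change playLaw μ s {x | p x}ᶜ = 0
  rw [playLaw, Measure.bind_apply hp.compl (measurable_lawGiven s).aemeasurable]
  refine lintegral_eq_zero_of_ae_eq_zero (h.mono fun w hw => ?_)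
  change lawGiven s w {x | p x}ᶜ = 0
  rw [lawGiven, Measure.map_apply measurable_prodMk_left hp.compl]
  exact hw

lemma ae_agentsLaw_of_playLaw {μ : Measure (stdSimplex ℝ S)} {s : ℕ → Strategy S}
    {p : Play S → Prop} (h : ∀ᵐ x ∂playLaw μ s, p x) :
    ∀ᵐ w ∂μ, ∀ᵐ y ∂agentsLaw s w, p (w, y) :=
  (Measure.ae_ae_of_ae_bind (measurable_lawGiven s).aemeasurable h).mono fun _ hw =>
    ae_of_ae_map measurable_prodMk_left.aemeasurable hw

lemma measurable_state : Measurable (state : Play S → stdSimplex ℝ S) := measurable_fst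

lemma measurable_agent (i : ℕ) : Measurable fun x : Play S => x.2 i :=
  (measurable_pi_apply i).comp measurable_snd

lemma measurable_signal (i : ℕ) : Measurable (signal i : Play S → S) :=
  measurable_fst.comp (measurable_agent i)

lemma measurable_repSignal (i : ℕ) : Measurable (repSignal i : Play S → S) :=
  measurable_fst.comp (measurable_snd.comp (measurable_agent i))

lemma measurable_repPred (i : ℕ) : Measurable (repPred i : Play S → stdSimplex ℝ S) :=
  measurable_snd.comp (measurable_snd.comp (measurable_agent i))

lemma lintegral_agentLaw (w : stdSimplex ℝ S) (t : Strategy S) {H : S × Report S → ℝ≥0∞}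
    (hH : Measurable H) :
    ∫⁻ p, H p ∂agentLaw w t
      = ∑ b, ENNReal.ofReal (w b) * ∫⁻ r, H (b, r) ∂(t b : Measure (Report S)) := by
  rw [agentLaw, lintegral_finsetSum_measure]
  refine Finset.sum_congr rfl fun b _ => ?_
  rw [lintegral_smul_measure, Measure.dirac_prod, lintegral_map hH measurable_prodMk_left,
    smul_eq_mul]

lemma lintegral_playLaw_agent (μ : Measure (stdSimplex ℝ S)) (s : ℕ → Strategy S) (i : ℕ)
    {H : stdSimplex ℝ S × (S × Report S) → ℝ≥0∞} (hH : Measurable H) :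
    ∫⁻ x, H (state x, x.2 i) ∂playLaw μ s
      = ∫⁻ w, ∑ b, ENNReal.ofReal (w b) * ∫⁻ r, H (w, b, r) ∂(s i b : Measure (Report S)) ∂μ := by
  rw [lintegral_playLaw μ s (H := fun x => H (state x, x.2 i))
    (hH.comp (measurable_state.prodMk (measurable_agent i)))]
  refine lintegral_congr fun w => ?_
  have hw : Measurable fun p => H (w, p) := hH.comp measurable_prodMk_left
  rw [← lintegral_agentLaw w (s i) hw, ← Measure.infinitePi_map_eval (fun i => agentLaw w (s i)) i,
    lintegral_map hw (measurable_pi_apply i)]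
  rfl

variable [DiscreteMeasurableSpace S]

lemma lintegral_playLaw_signal (μ : Measure (stdSimplex ℝ S)) (s : ℕ → Strategy S) (i : ℕ)
    {F : stdSimplex ℝ S → S → ℝ≥0∞} (hF : ∀ b, Measurable fun w => F w b) :
    ∫⁻ x, F (state x) (signal i x) ∂playLaw μ s
      = ∫⁻ w, ∑ b, ENNReal.ofReal (w b) * F w b ∂μ := by
  have hF' : Measurable fun p : stdSimplex ℝ S × S => F p.1 p.2 :=
    measurable_from_prod_countable_left hF
  have := lintegral_playLaw_agent μ s i (H := fun p => F p.1 p.2.1)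
    (hF'.comp (measurable_fst.prodMk (measurable_fst.comp measurable_snd)))
  simp only [lintegral_const, measure_univ, mul_one] at this
  exact this

lemma lintegral_playLaw_signal_pair (μ : Measure (stdSimplex ℝ S)) (s : ℕ → Strategy S) {i j : ℕ}
    (hij : i ≠ j) {F : stdSimplex ℝ S → S → S → ℝ≥0∞} (hF : ∀ a b, Measurable fun w => F w a b) :
    ∫⁻ x, F (state x) (signal i x) (signal j x) ∂playLaw μ s
      = ∫⁻ w, ∑ a, ∑ b, ENNReal.ofReal (w a) * ENNReal.ofReal (w b) * F w a b ∂μ := by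
  have hF' : Measurable fun p : stdSimplex ℝ S × (S × S) => F p.1 p.2.1 p.2.2 :=
    measurable_from_prod_countable_left fun p => hF p.1 p.2
  rw [lintegral_playLaw μ s (H := fun x => F (state x) (signal i x) (signal j x)) (hF'.comp
    (measurable_state.prodMk ((measurable_signal i).prodMk (measurable_signal j))))]
  refine lintegral_congr fun w => ?_
  have hw : Measurable fun p : (S × Report S) × (S × Report S) => F w p.1.1 p.2.1 :=
    (measurable_of_finite fun p : S × S => F w p.1 p.2).comp
      ((measurable_fst.comp measurable_fst).prodMk (measurable_fst.comp measurable_snd))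
  have h1 : ∫⁻ y, F w (y i).1 (y j).1 ∂agentsLaw s w
      = ∫⁻ p, F w p.1.1 p.2.1 ∂(agentLaw w (s i)).prod (agentLaw w (s j)) := by
    rw [← Measure.infinitePi_map_eval_prod (P := fun i => agentLaw w (s i)) hij,
      lintegral_map hw ((measurable_pi_apply i).prodMk (measurable_pi_apply j))]
  refine h1.trans ?_
  rw [lintegral_prod _ hw.aemeasurable, lintegral_agentLaw w (s i) hw.lintegral_prod_right']
  refine Finset.sum_congr rfl fun a _ => ?_
  have hj : ∫⁻ p : S × Report S, F w a p.1 ∂agentLaw w (s j)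
      = ∑ b, ENNReal.ofReal (w b) * F w a b := by
    rw [lintegral_agentLaw w (s j) (H := fun p => F w a p.1)
      ((measurable_of_finite (F w a)).comp measurable_fst)]
    simp
  simp only [hj, lintegral_const, measure_univ, mul_one, Finset.mul_sum, mul_assoc]

/-- If agent `i` modifies her report as a function of her signal, the play is modified in her
coordinate alone. -/
lemma playLaw_update (μ : Measure (stdSimplex ℝ S)) (s : ℕ → Strategy S) (i : ℕ) (t : Strategy S)
    {g : S → Report S → Report S} (hg : ∀ b, Measurable (g b))
    (ht : ∀ b, (t b : Measure (Report S)) = (s i b : Measure (Report S)).map (g b)) :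
    playLaw μ (Function.update s i t) = (playLaw μ s).map
      fun x => (x.1, Function.update x.2 i ((x.2 i).1, g (x.2 i).1 (x.2 i).2)) := by
  classical
  have hg' : Measurable fun p : S × Report S => (p.1, g p.1 p.2) :=
    measurable_fst.prodMk (measurable_from_prod_countable_right hg)
  set φ : ℕ → S × Report S → S × Report S := fun k => if k = i then fun p => (p.1, g p.1 p.2) else id
    with hφ
  have hφm : ∀ k, Measurable (φ k) := fun k => by
    rw [hφ]
    dsimp only
    split_ifs
    · exact hg'
    · exact measurable_id
  have hlaw : ∀ w, agentsLaw (Function.update s i t) w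
      = (agentsLaw s w).map fun y k => φ k (y k) := by
    intro w
    rw [Measure.infinitePi_map_pi _ hφm]
    refine congrArg Measure.infinitePi (funext fun k => ?_)
    by_cases hk : k = i
    · subst hk
      refine Measure.ext_of_lintegral _ fun H hH => ?_
      rw [lintegral_map hH (hφm k), lintegral_agentLaw _ _ hH,
        lintegral_agentLaw _ _ (H := fun p => H (φ k p)) (hH.comp (hφm k))]
      refine Finset.sum_congr rfl fun b _ => ?_
      rw [Function.update_self, ht,
        lintegral_map (f := fun r => H (b, r)) (hH.comp measurable_prodMk_left) (hg b)]
      simp [hφ]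
    · rw [Function.update_of_ne hk]
      simp [hφ, hk]
  have hΦ : (fun x : Play S => (x.1, Function.update x.2 i ((x.2 i).1, g (x.2 i).1 (x.2 i).2)))
      = fun x : Play S => (x.1, fun k => φ k (x.2 k)) := by
    funext x
    congr 1
    funext k
    by_cases hk : k = i
    · subst hk
      simp [hφ]
    · simp [hφ, hk]
  have hΨ : Measurable fun y : ℕ → S × Report S => fun k => φ k (y k) :=
    measurable_pi_lambda _ fun k => (hφm k).comp (measurable_pi_apply k)
  have hΨ' : Measurable fun x : Play S => (x.1, fun k => φ k (x.2 k)) :=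
    measurable_fst.prodMk (hΨ.comp measurable_snd)
  rw [hΦ]
  refine Measure.ext_of_lintegral _ fun H hH => ?_
  rw [lintegral_map hH hΨ', lintegral_playLaw μ _ hH,
    lintegral_playLaw μ _ (H := fun x => H (x.1, fun k => φ k (x.2 k))) (hH.comp hΨ')]
  refine lintegral_congr fun w => ?_
  rw [hlaw, lintegral_map (f := fun y => H (w, y)) (hH.comp measurable_prodMk_left) hΨ]

/-! ### Laws of large numbers -/

lemma measurable_freq {Ω : Type*} [MeasurableSpace Ω] {c : ℕ → Ω → S} (hc : ∀ k, Measurable (c k))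
    (a : S) (n : ℕ) : Measurable fun x =>
      (∑ k ∈ Finset.range n, Set.indicator {y | c k y = a} (fun _ => (1 : ℝ)) x) / n :=
  (Finset.measurable_sum _ fun k _ =>
    measurable_const.indicator (hc k (measurableSet_singleton a))).div_const _

lemma measurableSet_hasFreq {Ω : Type*} [MeasurableSpace Ω] {c : ℕ → Ω → S}
    (hc : ∀ k, Measurable (c k)) {l : Ω → S → ℝ} (hl : ∀ a, Measurable fun x => l x a) :
    MeasurableSet {x | HasFreq (fun k => c k x) (l x)} := by
  simp_rw [hasFreq_iff, ofPred_forall]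
  exact MeasurableSet.iInter fun a =>
    measurableSet_tendsto_fun (fun n => measurable_freq hc a n) (hl a)

lemma ae_hasFreq_signal (μ : Measure (stdSimplex ℝ S)) (s : ℕ → Strategy S) :
    ∀ᵐ x ∂playLaw μ s, HasFreq (fun k => signal k x) (state x) := by
  refine ae_playLaw (measurableSet_hasFreq measurable_signal
    fun a => (measurable_coord a).comp measurable_state) (ae_of_all _ fun w => ?_)
  have hm : ∀ k, Measurable fun y : ℕ → S × Report S => (y k).1 := fun k =>
    measurable_fst.comp (measurable_pi_apply k)
  have hlaw : ∀ k, (agentsLaw s w).map (fun y => (y k).1)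
      = ∑ b, ENNReal.ofReal (w b) • Measure.dirac b := by
    intro k
    refine Measure.ext_of_lintegral _ fun H hH => ?_
    have h1 := lintegral_agentLaw w (s k) (hH.comp measurable_fst)
    rw [lintegral_map hH (hm k), lintegral_finsetSum_measure]
    simp_rw [lintegral_smul_measure, lintegral_dirac]
    rw [← Measure.infinitePi_map_eval (fun i => agentLaw w (s i)) k,
      lintegral_map (hH.comp measurable_fst) (measurable_pi_apply k)] at h1
    simpa using h1
  suffices h : ∀ᵐ y ∂agentsLaw s w, HasFreq (fun k => (y k).1) w from h
  simp_rw [hasFreq_iff (c := fun k (y : ℕ → S × Report S) => (y k).1)]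
  rw [ae_all_iff]
  intro a
  have hind : Measurable (Set.indicator {b : S | b = a} fun _ => (1 : ℝ)) := measurable_of_finite _
  have hX : ∀ k, Measurable fun y : ℕ → S × Report S =>
      Set.indicator {b : S | b = a} (fun _ => (1 : ℝ)) (y k).1 := fun k => hind.comp (hm k)
  have hs : ({b : S | b = a} : Set S) = {a} := rfl
  have hint : ∫ y, Set.indicator {b : S | b = a} (fun _ => (1 : ℝ)) (y 0).1 ∂agentsLaw s w
      = w a := by
    rw [← integral_map (hm 0).aemeasurable (f := Set.indicator {b : S | b = a} fun _ => (1 : ℝ))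
      hind.aestronglyMeasurable, hs, integral_indicator_const _ (measurableSet_singleton a),
      measureReal_def, hlaw, Measure.finsetSum_apply, Finset.sum_eq_single a]
    · simp [ENNReal.toReal_ofReal (coord_nonneg w a)]
    · intro b _ hb
      simp [hb]
    · simp
  rw [← hint]
  refine strong_law_ae_real
    (fun k (y : ℕ → S × Report S) => Set.indicator {b : S | b = a} (fun _ => (1 : ℝ)) (y k).1)
    ?_ ?_ ?_
  · refine Integrable.of_bound (hX 0).aestronglyMeasurable 1 (ae_of_all _ fun y => ?_)
    by_cases h : (y 0).1 = a <;> simp [h]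
  · intro k l hkl
    exact (iIndepFun_infinitePi (P := fun i => agentLaw w (s i))
      (X := fun _ p => Set.indicator {b : S | b = a} (fun _ => (1 : ℝ)) p.1)
      fun _ => hind.comp measurable_fst).indepFun hkl
  · intro k
    have h : IdentDistrib (fun y : ℕ → S × Report S => (y k).1) (fun y => (y 0).1)
        (agentsLaw s w) (agentsLaw s w) :=
      ⟨(hm k).aemeasurable, (hm 0).aemeasurable, by rw [hlaw, hlaw]⟩
    exact h.comp hind

end Law

/-! ### The distribution of the reported signals is a garbling of the state -/

section Channel

variable {S : Type*} [Fintype S] [MeasurableSpace S] [DiscreteMeasurableSpace S]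

lemma measurableSet_report (a : S) : MeasurableSet {r : Report S | r.1 = a} :=
  measurable_fst (measurableSet_singleton a)

/-- The distribution of the reported signal, as a function of the private signal, of an agent who
uses the strategy `t`. -/
def repChannel (t : Strategy S) (b : S) : stdSimplex ℝ S :=
  ⟨fun a => (t b : Measure (Report S)).real {r | r.1 = a}, by
    refine ⟨fun a => measureReal_nonneg, ?_⟩
    have := sum_measureReal_preimage_singleton (μ := (t b : Measure (Report S))) Finset.univ
      (f := Prod.fst) fun a _ => measurableSet_report a
    rw [Finset.coe_univ, preimage_univ, probReal_univ] at this
    exact this⟩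

/-- The average of the channels of the agents `0, …, n`. -/
def avgChannel (s : ℕ → Strategy S) (n : ℕ) (b : S) : stdSimplex ℝ S :=
  ⟨fun a => (∑ k ∈ Finset.range (n + 1), repChannel (s k) b a) / ((n + 1 : ℕ) : ℝ), by
    refine ⟨fun a => div_nonneg (Finset.sum_nonneg fun k _ => coord_nonneg _ _)
      (Nat.cast_nonneg _), ?_⟩
    have h : ((n + 1 : ℕ) : ℝ) ≠ 0 := Nat.cast_ne_zero.2 (Nat.succ_ne_zero n)
    rw [← Finset.sum_div, Finset.sum_comm]
    simp_rw [sum_coord]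
    rw [Finset.sum_const, Finset.card_range, nsmul_eq_mul, mul_one, div_self h]⟩

lemma avgChannel_apply (s : ℕ → Strategy S) (n : ℕ) (b a : S) : avgChannel s n b a
    = (∑ k ∈ Finset.range (n + 1), repChannel (s k) b a) / ((n + 1 : ℕ) : ℝ) := rfl

lemma agentLaw_report (w : stdSimplex ℝ S) (t : Strategy S) (a : S) :
    (agentLaw w t).real {p | p.2.1 = a} = garble (repChannel t) w a := by
  have hm : MeasurableSet {p : S × Report S | p.2.1 = a} :=
    (measurable_fst.comp measurable_snd) (measurableSet_singleton a)
  have h := lintegral_agentLaw w t (measurable_one.indicator hm)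
  rw [lintegral_indicator_one hm] at h
  rw [measureReal_def, h, ENNReal.toReal_sum fun b _ => ?_]
  · rw [garble_apply]
    refine Finset.sum_congr rfl fun b _ => ?_
    have e : ∫⁻ r, ({p : S × Report S | p.2.1 = a}).indicator (1 : S × Report S → ℝ≥0∞) (b, r)
        ∂(t b : Measure (Report S)) = (t b : Measure (Report S)) {r | r.1 = a} := by
      rw [← lintegral_indicator_one (measurableSet_report a)]
      rfl
    rw [e, ENNReal.toReal_mul, ENNReal.toReal_ofReal (coord_nonneg _ _)]
    rfl
  · refine ENNReal.mul_ne_top ENNReal.ofReal_ne_top (ne_top_of_le_ne_top ENNReal.one_ne_top ?_)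
    refine (lintegral_mono fun r => indicator_le_self' (fun _ _ => zero_le) _).trans ?_
    simp

/-- The mean squared deviation of the empirical frequency of a report from its conditional
expectation given the state is at most the inverse of the number of agents. -/
lemma lintegral_freq_sub_sq_le (s : ℕ → Strategy S) (w : stdSimplex ℝ S) (a : S) (n : ℕ) :
    ∫⁻ y, ENNReal.ofReal (((∑ k ∈ Finset.range (n + 1),
        Set.indicator {y : ℕ → S × Report S | (y k).2.1 = a} (fun _ => (1 : ℝ)) y)
        / ((n + 1 : ℕ) : ℝ) - garble (avgChannel s n) w a) ^ 2) ∂agentsLaw s w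
      ≤ ENNReal.ofReal (1 / ((n + 1 : ℕ) : ℝ)) := by
  set N : ℝ := ((n + 1 : ℕ) : ℝ) with hN
  have hN0 : 0 < N := Nat.cast_pos.2 n.succ_pos
  set X : ℕ → (ℕ → S × Report S) → ℝ := fun k =>
    Set.indicator {y | (y k).2.1 = a} (fun _ => (1 : ℝ)) with hX
  have hset : ∀ k, MeasurableSet {y : ℕ → S × Report S | (y k).2.1 = a} := fun k =>
    (measurable_fst.comp (measurable_snd.comp (measurable_pi_apply k))) (measurableSet_singleton a)
  have hXm : ∀ k, Measurable (X k) := fun k => measurable_const.indicator (hset k)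
  have hX01 : ∀ k y, X k y ∈ Set.Icc (0 : ℝ) 1 := fun k y => by
    by_cases h : (y k).2.1 = a <;> simp [hX, h]
  have hXL : ∀ k, MemLp (X k) 2 (agentsLaw s w) := fun k =>
    MemLp.of_bound (hXm k).aestronglyMeasurable 1 (ae_of_all _ fun y => by
      rw [Real.norm_of_nonneg (hX01 k y).1]; exact (hX01 k y).2)
  have hmean : ∀ k, ∫ y, X k y ∂agentsLaw s w = garble (repChannel (s k)) w a := by
    intro k
    rw [hX, integral_indicator_const _ (hset k), smul_eq_mul, mul_one, ← agentLaw_report,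
      ← Measure.infinitePi_map_eval (fun i => agentLaw w (s i)) k,
      map_measureReal_apply (measurable_pi_apply k)
        ((measurable_fst.comp measurable_snd) (measurableSet_singleton a))]
    rfl
  have hsumm : Measurable (∑ k ∈ Finset.range (n + 1), X k) := by
    have := Finset.measurable_sum (Finset.range (n + 1)) fun k _ => hXm k
    convert this using 1
    funext y
    simp
  have hmeanN : ∫ y, (∑ k ∈ Finset.range (n + 1), X k) y ∂agentsLaw s w
      = N * garble (avgChannel s n) w a := by
    simp_rw [Finset.sum_apply]
    rw [integral_finsetSum _ fun k _ => (hXL k).integrable one_le_two]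
    simp_rw [hmean, garble_apply, avgChannel_apply, ← hN]
    rw [Finset.sum_comm, Finset.mul_sum]
    refine Finset.sum_congr rfl fun b _ => ?_
    rw [← Finset.mul_sum]
    field_simp
  have hvar : variance (∑ k ∈ Finset.range (n + 1), X k) (agentsLaw s w) ≤ N := by
    rw [IndepFun.variance_sum fun k _ => hXL k]
    · refine (Finset.sum_le_sum (g := fun _ => (1 : ℝ)) fun k _ => ?_).trans ?_
      · refine (variance_le_sq_of_bounded (ae_of_all _ (hX01 k)) (hXm k).aemeasurable).trans ?_
        norm_num
      · simp [hN]
    · intro k _ l _ hkl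
      exact (iIndepFun_infinitePi (P := fun i => agentLaw w (s i))
        (X := fun _ p => Set.indicator {p : S × Report S | p.2.1 = a} (fun _ => (1 : ℝ)) p)
        fun _ => measurable_const.indicator ((measurable_fst.comp measurable_snd)
          (measurableSet_singleton a))).indepFun hkl
  have hint : Integrable (fun y => ((∑ k ∈ Finset.range (n + 1), X k) y
      - N * garble (avgChannel s n) w a) ^ 2) (agentsLaw s w) := by
    have : MemLp (∑ k ∈ Finset.range (n + 1), X k) 2 (agentsLaw s w) :=
      memLp_finsetSum' _ fun k _ => hXL k
    exact (this.sub (memLp_const _)).integrable_sq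
  rw [variance_eq_integral hsumm.aemeasurable, hmeanN] at hvar
  have e : ∀ y, ((∑ k ∈ Finset.range (n + 1), X k y) / N - garble (avgChannel s n) w a) ^ 2
      = (N⁻¹) ^ 2 * ((∑ k ∈ Finset.range (n + 1), X k) y - N * garble (avgChannel s n) w a) ^ 2 :=
    fun y => by
      rw [Finset.sum_apply, ← mul_pow]
      congr 1
      field_simp
  refine (lintegral_congr fun y => congrArg ENNReal.ofReal (e y)).trans_le ?_
  rw [← ofReal_integral_eq_lintegral_ofReal (hint.const_mul _)
    (ae_of_all _ fun y => by positivity), integral_const_mul]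
  refine ENNReal.ofReal_le_ofReal ?_
  calc (N⁻¹) ^ 2 * _ ≤ (N⁻¹) ^ 2 * N := mul_le_mul_of_nonneg_left hvar (by positivity)
    _ = 1 / N := by field_simp

lemma ae_eq_zero_of_tendsto_lintegral_sq {Ω : Type*} [MeasurableSpace Ω] {P : Measure Ω}
    {Z : ℕ → Ω → ℝ} {L : Ω → ℝ} (hZ : ∀ n, Measurable (Z n))
    (h0 : Tendsto (fun n => ∫⁻ x, ENNReal.ofReal (Z n x ^ 2) ∂P) atTop (𝓝 0))
    (hL : ∀ᵐ x ∂P, Tendsto (fun n => Z n x) atTop (𝓝 (L x))) : ∀ᵐ x ∂P, L x = 0 := by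
  have hm : ∀ n, Measurable fun x => ENNReal.ofReal (Z n x ^ 2) := fun n =>
    ((hZ n).pow_const 2).ennreal_ofReal
  have hml : Measurable fun x => liminf (fun n => ENNReal.ofReal (Z n x ^ 2)) atTop :=
    Measurable.liminf hm
  have h1 : ∫⁻ x, liminf (fun n => ENNReal.ofReal (Z n x ^ 2)) atTop ∂P
      ≤ liminf (fun n => ∫⁻ x, ENNReal.ofReal (Z n x ^ 2) ∂P) atTop := lintegral_liminf_le hm
  rw [h0.liminf_eq, nonpos_iff_eq_zero, lintegral_eq_zero_iff hml] at h1
  filter_upwards [h1, hL] with x hx hLx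
  have h2 : Tendsto (fun n => ENNReal.ofReal (Z n x ^ 2)) atTop (𝓝 (ENNReal.ofReal (L x ^ 2))) :=
    (ENNReal.continuous_ofReal.tendsto _).comp (hLx.pow 2)
  rw [h2.liminf_eq, Pi.zero_apply, ENNReal.ofReal_eq_zero] at hx
  exact pow_eq_zero_iff two_ne_zero |>.1 (le_antisymm hx (sq_nonneg _))

/-- If the distribution of the reported signals exists, it is a garbling of the state: by
compactness the average channels converge along a subsequence, and along it the empirical
frequencies converge in mean square to the garbled state. -/
lemma HasReportDist.exists_channel {μ : Measure (stdSimplex ℝ S)} {s : ℕ → Strategy S}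
    (h : HasReportDist μ s) : ∃ θ : S → stdSimplex ℝ S,
      ∀ᵐ x ∂playLaw μ s, HasFreq (fun k => repSignal k x) (garble θ (state x)) := by
  classical
  obtain ⟨θ, φ, hφ, hθ⟩ := CompactSpace.tendsto_subseq (avgChannel s)
  refine ⟨θ, ae_playLaw (measurableSet_hasFreq measurable_repSignal
    fun a => (measurable_garble_apply θ a).comp measurable_state) ?_⟩
  filter_upwards [ae_agentsLaw_of_playLaw h] with w hw
  suffices hs : ∀ᵐ y ∂agentsLaw s w,
      HasFreq (fun k => (y k).2.1) (garble θ w) from hs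
  simp_rw [hasFreq_iff (c := fun k (y : ℕ → S × Report S) => (y k).2.1)]
  rw [ae_all_iff]
  intro a
  have hlim : ∀ᵐ y ∂agentsLaw s w, ∃ l, Tendsto (fun n : ℕ => (∑ k ∈ Finset.range n,
      Set.indicator {y : ℕ → S × Report S | (y k).2.1 = a} (fun _ => (1 : ℝ)) y) / n)
      atTop (𝓝 l) := by
    filter_upwards [hw] with y hy
    obtain ⟨l, hl⟩ := hy a
    refine ⟨l, hl.congr fun n => ?_⟩
    rw [ncard_eq_sum_ite]
    congr 1
  have hchan : Tendsto (fun n => garble (avgChannel s (φ n)) w a) atTop (𝓝 (garble θ w a)) := by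
    simp_rw [garble_apply]
    refine tendsto_finsetSum _ fun b _ => Tendsto.const_mul _ ?_
    have h1 := (continuous_apply b).tendsto θ |>.comp hθ
    exact ((continuous_apply a).tendsto _).comp ((continuous_subtype_val.tendsto _).comp h1)
  have hsucc : Tendsto (fun n => φ n + 1) atTop atTop :=
    (tendsto_add_atTop_nat 1).comp hφ.tendsto_atTop
  -- Off the null set on which the frequencies diverge, `l` is their limit.
  set l : (ℕ → S × Report S) → ℝ := fun y => limUnder atTop fun n : ℕ => (∑ k ∈ Finset.range n,
      Set.indicator {y : ℕ → S × Report S | (y k).2.1 = a} (fun _ => (1 : ℝ)) y) / n with hl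
  have hlim' : ∀ᵐ y ∂agentsLaw s w, Tendsto (fun n : ℕ => (∑ k ∈ Finset.range n,
      Set.indicator {y : ℕ → S × Report S | (y k).2.1 = a} (fun _ => (1 : ℝ)) y) / n)
      atTop (𝓝 (l y)) := hlim.mono fun y hy => tendsto_nhds_limUnder hy
  have hzero := ae_eq_zero_of_tendsto_lintegral_sq (P := agentsLaw s w)
    (Z := fun n y => (∑ k ∈ Finset.range (φ n + 1),
      Set.indicator {y : ℕ → S × Report S | (y k).2.1 = a} (fun _ => (1 : ℝ)) y)
        / ((φ n + 1 : ℕ) : ℝ) - garble (avgChannel s (φ n)) w a)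
    (L := fun y => l y - garble θ w a)
    (fun n => (measurable_freq (fun k => measurable_fst.comp
      (measurable_snd.comp (measurable_pi_apply k))) a (φ n + 1)).sub_const _)
    (by
      refine tendsto_of_tendsto_of_tendsto_of_le_of_le tendsto_const_nhds ?_
        (fun n => zero_le) (fun n => lintegral_freq_sub_sq_le s w a (φ n))
      rw [← ENNReal.ofReal_zero]
      exact (ENNReal.continuous_ofReal.tendsto 0).comp
        ((tendsto_const_div_atTop_nhds_zero_nat 1).comp hsucc))
    (hlim'.mono fun y hy => (hy.comp hsucc).sub hchan)
  filter_upwards [hzero, hlim'] with y h1 h2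
  rwa [sub_eq_zero.1 h1] at h2

end Channel

/-! ### Predictions in equilibrium -/

section Prediction

variable {S : Type*} [Fintype S] (μ : Measure (stdSimplex ℝ S)) [IsProbabilityMeasure μ]
  (θ : S → stdSimplex ℝ S)

/-- The part of the law of the state on which a given agent receives the signal `b`. -/
def signalPart (b : S) : Measure (stdSimplex ℝ S) :=
  μ.withDensity fun w => ENNReal.ofReal (w b)

lemma signalPart_univ (b : S) : signalPart μ b univ = ENNReal.ofReal (priorProb μ b) := by
  rw [signalPart, withDensity_apply _ MeasurableSet.univ, setLIntegral_univ, priorProb,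
    ofReal_integral_eq_lintegral_ofReal (integrable_coord μ b)
      (ae_of_all _ fun w => coord_nonneg w b)]

instance signalPart_finite (b : S) : IsFiniteMeasure (signalPart μ b) :=
  ⟨by rw [signalPart_univ]; exact ENNReal.ofReal_lt_top⟩

lemma integral_garble_signalPart (a b : S) : ∫ w, garble θ w a ∂signalPart μ b
    = (signalPart μ b).real univ * garble θ (posterior μ b) a := by
  rw [measureReal_def, signalPart_univ, ENNReal.toReal_ofReal (priorProb_nonneg μ b),
    priorProb_mul_garble_posterior, signalPart,
    integral_withDensity_eq_integral_toReal_smul (measurable_coord b).ennreal_ofReal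
      (ae_of_all _ fun w => ENNReal.ofReal_lt_top)]
  refine integral_congr_ae (ae_of_all _ fun w => ?_)
  simp [ENNReal.toReal_ofReal (coord_nonneg w b)]

lemma lintegral_klTerm_signalPart (a b : S) {p : ℝ} (hp : 0 ≤ p) :
    ∫⁻ w, klTerm (garble θ w a) (garble θ (posterior μ b) a) ∂signalPart μ b ≠ ⊤ ∧
      ∫⁻ w, klTerm (garble θ w a) p ∂signalPart μ b
        = ∫⁻ w, klTerm (garble θ w a) (garble θ (posterior μ b) a) ∂signalPart μ b
          + signalPart μ b univ * klTerm (garble θ (posterior μ b) a) p :=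
  lintegral_klTerm (measurable_garble_apply θ a) (fun _ => coord_nonneg _ _)
    (fun _ => coord_le_one _ _) (coord_nonneg _ _) hp (integral_garble_signalPart μ θ a b)

/-- The divergence of the prediction of agent `i` from the garbled state. -/
def predLoss (i : ℕ) (x : Play S) : ℝ≥0∞ :=
  ∑ a, klTerm (garble θ (state x) a) (repPred i x a)

/-- The divergence from the garbled state of the posterior prediction of agent `i`. -/
def posteriorLoss (i : ℕ) (x : Play S) : ℝ≥0∞ :=
  ∑ a, klTerm (garble θ (state x) a) (garble θ (posterior μ (signal i x)) a)

lemma predScore_eq {x : Play S} (hx : HasFreq (fun k => repSignal k x) (garble θ (state x)))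
    (i : ℕ) : predScore i x = -(predLoss θ i x : EReal) := by
  unfold predScore reportDist
  simp_rw [hx.frac_eq]
  exact sum_mul_log_sub_log (garble θ (state x)).2 (repPred i x).2

variable [MeasurableSpace S]

lemma measurable_predLoss (i : ℕ) : Measurable (predLoss θ i) :=
  Finset.measurable_sum _ fun a _ => measurable_klTerm
    ((measurable_garble_apply θ a).comp measurable_state)
    ((measurable_coord a).comp (measurable_repPred i))

lemma measurable_agentAvg {Ω : Type*} [MeasurableSpace Ω] (T : Finset ℕ) {g : ℕ → Ω → EReal}
    (hg : ∀ k, Measurable (g k)) : Measurable fun x => agentAvg T fun k => g k x := by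
  unfold agentAvg
  refine Measurable.limsup fun n => ?_
  simp_rw [EReal.div_eq_inv_mul]
  exact (Finset.measurable_sum _ fun k _ => hg k).const_mul _

variable [DiscreteMeasurableSpace S]

lemma measurable_reportDist : Measurable (reportDist : Play S → S → ℝ) := by
  classical
  refine measurable_pi_lambda _ fun a => (measurable_agentAvg ∅ fun k => ?_).ereal_toReal
  exact Measurable.ite (measurable_repSignal k (measurableSet_singleton a)) measurable_const
    measurable_const

lemma measurable_apply_discrete {Ω β γ C : Type*} [MeasurableSpace Ω] [MeasurableSpace β]
    [MeasurableSpace γ] [Countable C] [MeasurableSpace C] [DiscreteMeasurableSpace C]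
    {F : β → C → γ} (hF : ∀ b, Measurable fun v => F v b) {u : Ω → β} {c : Ω → C}
    (hu : Measurable u) (hc : Measurable c) : Measurable fun x => F (u x) (c x) :=
  (measurable_from_prod_countable_left (f := fun p : β × C => F p.1 p.2) hF).comp (hu.prodMk hc)

lemma measurable_eval {Ω : Type*} [MeasurableSpace Ω] {p : Ω → stdSimplex ℝ S} {c : Ω → S}
    (hp : Measurable p) (hc : Measurable c) : Measurable fun x => p x (c x) :=
  measurable_apply_discrete (F := fun (w : stdSimplex ℝ S) a => w a) measurable_coord hp hc

variable (s : ℕ → Strategy S)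

lemma lintegral_playLaw_report (i : ℕ)
    {H : stdSimplex ℝ S → S → Report S → ℝ≥0∞}
    (hH : ∀ b, Measurable fun p : stdSimplex ℝ S × Report S => H p.1 b p.2) :
    ∫⁻ x, H (state x) (signal i x) (x.2 i).2 ∂playLaw μ s
      = ∑ b, ∫⁻ r, ∫⁻ w, H w b r ∂signalPart μ b ∂(s i b : Measure (Report S)) := by
  have hH' : Measurable fun p : stdSimplex ℝ S × (S × Report S) => H p.1 p.2.1 p.2.2 := by
    have : Measurable fun p : (stdSimplex ℝ S × Report S) × S => H p.1.1 p.2 p.1.2 :=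
      measurable_from_prod_countable_left hH
    exact this.comp ((measurable_fst.prodMk (measurable_snd.comp measurable_snd)).prodMk
      (measurable_fst.comp measurable_snd))
  have hinner : ∀ b, Measurable fun w => ∫⁻ r, H w b r ∂(s i b : Measure (Report S)) := fun b =>
    (hH b).lintegral_prod_right'
  refine (lintegral_playLaw_agent μ s i hH').trans ?_
  have hterm : ∀ b ∈ Finset.univ, Measurable fun w : stdSimplex ℝ S =>
      ENNReal.ofReal (w b) * ∫⁻ r, H w b r ∂(s i b : Measure (Report S)) := fun b _ =>
    (measurable_coord b).ennreal_ofReal.mul (hinner b)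
  refine (lintegral_finsetSum _ hterm).trans ?_
  refine Finset.sum_congr rfl fun b _ => ?_
  rw [← lintegral_lintegral_swap (f := fun w r => H w b r) (μ := signalPart μ b)
    (hH b).aemeasurable, signalPart,
    lintegral_withDensity_eq_lintegral_mul _ (measurable_coord b).ennreal_ofReal (hinner b)]
  rfl

lemma measurable_posteriorLoss (i : ℕ) : Measurable (posteriorLoss μ θ i) :=
  Finset.measurable_sum _ fun a _ => measurable_klTerm
    ((measurable_garble_apply θ a).comp measurable_state)
    ((measurable_of_finite fun b => garble θ (posterior μ b) a).comp (measurable_signal i))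

lemma lintegral_posteriorLoss_ne_top (i : ℕ) :
    ∫⁻ x, posteriorLoss μ θ i x ∂playLaw μ s ≠ ⊤ := by
  have hm : ∀ a b, Measurable fun w : stdSimplex ℝ S =>
      klTerm (garble θ w a) (garble θ (posterior μ b) a) := fun a b =>
    measurable_klTerm (measurable_garble_apply θ a) measurable_const
  have h := lintegral_playLaw_report μ s i
    (H := fun w b _ => ∑ a, klTerm (garble θ w a) (garble θ (posterior μ b) a))
    fun b => Finset.measurable_sum _ fun a _ => (hm a b).comp measurable_fst
  change ∫⁻ x, posteriorLoss μ θ i x ∂playLaw μ s = _ at h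
  rw [h]
  refine (ENNReal.sum_lt_top.2 fun b _ => ?_).ne
  rw [lintegral_const, measure_univ, mul_one, lintegral_finsetSum _ fun a _ => hm a b]
  exact ENNReal.sum_lt_top.2 fun a _ =>
    (lintegral_klTerm_signalPart μ θ a b le_rfl).1.lt_top

/-- A prediction that does not do worse than the posterior is the posterior. -/
lemma ae_repPred_eq_of_lintegral_le {i : ℕ}
    (h : ∫⁻ x, predLoss θ i x ∂playLaw μ s ≤ ∫⁻ x, posteriorLoss μ θ i x ∂playLaw μ s) :
    ∀ᵐ x ∂playLaw μ s, repPred i x = garble θ (posterior μ (signal i x)) := by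
  set D : Play S → ℝ≥0∞ := fun x =>
    ∑ a, klTerm (garble θ (posterior μ (signal i x)) a) (repPred i x a) with hD
  have hpost : ∀ a b, Measurable fun w : stdSimplex ℝ S =>
      klTerm (garble θ w a) (garble θ (posterior μ b) a) := fun a b =>
    measurable_klTerm (measurable_garble_apply θ a) measurable_const
  have hcoord : ∀ a, Measurable fun p : stdSimplex ℝ S × Report S => p.2.2 a := fun a =>
    (measurable_coord a).comp (measurable_snd.comp measurable_snd)
  have hDm : Measurable D := Finset.measurable_sum _ fun a _ => measurable_klTerm
    ((measurable_of_finite fun b => garble θ (posterior μ b) a).comp (measurable_signal i))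
    ((measurable_coord a).comp (measurable_repPred i))
  have e1 := lintegral_playLaw_report μ s i
    (H := fun w _ r => ∑ a, klTerm (garble θ w a) (r.2 a))
    fun b => Finset.measurable_sum _ fun a _ => measurable_klTerm
      ((measurable_garble_apply θ a).comp measurable_fst) (hcoord a)
  have e2 := lintegral_playLaw_report μ s i
    (H := fun w b r => ∑ a, (klTerm (garble θ w a) (garble θ (posterior μ b) a)
      + klTerm (garble θ (posterior μ b) a) (r.2 a)))
    fun b => Finset.measurable_sum _ fun a _ => ((hpost a b).comp measurable_fst).add
      (measurable_klTerm measurable_const (hcoord a))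
  -- The excess loss of a prediction over the posterior is its divergence from the posterior.
  have heq : ∫⁻ x, predLoss θ i x ∂playLaw μ s
      = ∫⁻ x, posteriorLoss μ θ i x ∂playLaw μ s + ∫⁻ x, D x ∂playLaw μ s := by
    rw [← lintegral_add_left (measurable_posteriorLoss μ θ i)]
    simp_rw [Finset.sum_add_distrib] at e2
    refine e1.trans (Eq.trans ?_ e2.symm)
    refine Finset.sum_congr rfl fun b _ => lintegral_congr fun r => ?_
    rw [lintegral_finsetSum _ fun a _ => measurable_klTerm (measurable_garble_apply θ a)
      measurable_const, lintegral_add_right _ measurable_const,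
      lintegral_finsetSum _ fun a _ => hpost a b, lintegral_const, Finset.sum_mul,
      ← Finset.sum_add_distrib]
    refine Finset.sum_congr rfl fun a _ => ?_
    rw [(lintegral_klTerm_signalPart μ θ a b (coord_nonneg r.2 a)).2, mul_comm]
  have hD0 : ∫⁻ x, D x ∂playLaw μ s = 0 := by
    rw [heq] at h
    have hfin := lintegral_posteriorLoss_ne_top μ θ s i
    have : ∫⁻ x, posteriorLoss μ θ i x ∂playLaw μ s + ∫⁻ x, D x ∂playLaw μ s
        ≤ ∫⁻ x, posteriorLoss μ θ i x ∂playLaw μ s + 0 := by rwa [add_zero]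
    exact nonpos_iff_eq_zero.1 ((ENNReal.add_le_add_iff_left hfin).1 this)
  rw [lintegral_eq_zero_iff hDm] at hD0
  filter_upwards [hD0] with x hx
  refine simplex_ext fun a => (eq_of_klTerm_eq_zero (coord_nonneg _ _) (coord_nonneg _ _) ?_).symm
  exact (Finset.sum_eq_zero_iff.1 hx) a (Finset.mem_univ a)

variable {μ s θ}

/-- In equilibrium every agent predicts her posterior of the distribution of the reported signals:
the deviation to that prediction leaves her information score unchanged. -/
lemma IsEquilibrium.ae_repPred_eq {α : ℝ} {f : ℝ → ℝ} (hf : ConvexOn ℝ (Ioi 0) f)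
    (hs : IsEquilibrium μ α f s)
    (hfreq : ∀ᵐ x ∂playLaw μ s, HasFreq (fun k => repSignal k x) (garble θ (state x))) (i : ℕ) :
    ∀ᵐ x ∂playLaw μ s, repPred i x = garble θ (posterior μ (signal i x)) := by
  refine ae_repPred_eq_of_lintegral_le μ θ s ?_
  set g : S → Report S → Report S := fun b r => (r.1, garble θ (posterior μ b)) with hg
  have hgm : ∀ b, Measurable (g b) := fun b => measurable_fst.prodMk measurable_const
  set t : Strategy S := fun b => (s i b).map (hgm b).aemeasurable with ht
  set Φ : Play S → Play S :=
    fun x => (x.1, Function.update x.2 i ((x.2 i).1, g (x.2 i).1 (x.2 i).2)) with hΦ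
  have hlaw : playLaw μ (Function.update s i t) = (playLaw μ s).map Φ :=
    playLaw_update μ s i t hgm fun b => rfl
  have hΦm : Measurable Φ := by
    refine measurable_fst.prodMk (measurable_pi_lambda _ fun k => ?_)
    by_cases hk : k = i
    · subst hk
      simp only [Function.update_self]
      exact (measurable_signal k).prodMk ((measurable_repSignal k).prodMk
        ((measurable_of_finite fun b => garble θ (posterior μ b)).comp (measurable_signal k)))
    · simp only [Function.update_of_ne hk]
      exact measurable_agent k
  have hΦrep : ∀ k x, repSignal k (Φ x) = repSignal k x := fun k x => by
    by_cases hk : k = i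
    · subst hk
      simp [hΦ, repSignal, hg]
    · simp [hΦ, repSignal, hk]
  have hΦstate : ∀ x, state (Φ x) = state x := fun x => rfl
  have hΦpred : ∀ x, repPred i (Φ x) = garble θ (posterior μ (signal i x)) := fun x => by
    simp [hΦ, repPred, hg, signal]
  have hΦpred' : ∀ k, k ≠ i → ∀ x, repPred k (Φ x) = repPred k x := fun k hk x => by
    simp [hΦ, repPred, hk]
  -- A measurable version of the information score.
  set I : Play S → EReal := fun x => agentAvg {i} fun j =>
    ((f (repPred j x (repSignal i x) / garble θ (state x) (repSignal i x)) : ℝ) : EReal) with hI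
  have hIm : Measurable I := measurable_agentAvg {i} fun j =>
    (measurable_comp_of_nonneg hf ((measurable_eval (measurable_repPred j)
      (measurable_repSignal i)).div (measurable_eval ((measurable_garble θ).comp measurable_state)
        (measurable_repSignal i))) fun x => div_nonneg (coord_nonneg _ _)
          (coord_nonneg _ _)).coe_real_ereal
  have hΦI : ∀ x, I (Φ x) = I x := fun x => by
    simp only [hI, hΦrep, hΦstate]
    refine congrArg (fun u => limsup u atTop) (funext fun n => ?_)
    congr 1
    refine Finset.sum_congr rfl fun j hj => ?_
    have hji : j ≠ i := fun h => (Finset.mem_sdiff.1 hj).2 (Finset.mem_singleton.2 h)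
    dsimp only
    rw [hΦpred' j hji]
  have hpay : ∀ x, HasFreq (fun k => repSignal k x) (garble θ (state x)) →
      payment α f i x = -(predLoss θ i x : EReal) + (α : EReal) * I x := fun x hx => by
    rw [payment, predScore_eq θ hx]
    simp only [hI, infoScore, infoScoreRef, hx.frac_eq]
  have hfreq' : ∀ᵐ x ∂(playLaw μ s).map Φ,
      HasFreq (fun k => repSignal k x) (garble θ (state x)) := by
    rw [ae_map_iff hΦm.aemeasurable (measurableSet_hasFreq (l := fun x => garble θ (state x))
      measurable_repSignal fun a => (measurable_garble_apply θ a).comp measurable_state)]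
    simpa only [hΦrep, hΦstate] using hfreq
  have e1 : expect (playLaw μ s) (payment α f i)
      = expect (playLaw μ s) fun x => -(predLoss θ i x : EReal) + (α : EReal) * I x :=
    expect_congr (hfreq.mono hpay)
  have hm : Measurable fun x => -(predLoss θ i x : EReal) + (α : EReal) * I x :=
    (measurable_predLoss θ i).coe_ereal_ennreal.neg.add (hIm.const_mul _)
  have e2 : expect (playLaw μ (Function.update s i t)) (payment α f i)
      = expect (playLaw μ s) fun x => -(posteriorLoss μ θ i x : EReal) + (α : EReal) * I x := by
    rw [hlaw, expect_congr (hfreq'.mono hpay), expect_map hΦm hm]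
    simp only [hΦI, predLoss, hΦstate, hΦpred, posteriorLoss]
  obtain ⟨h1, h2, h3⟩ := hs i
  have h3 := h3 t
  rw [e1] at h1 h2 h3
  rw [e2] at h3
  exact lintegral_le_of_expect_le (measurable_predLoss θ i) (measurable_posteriorLoss μ θ i)
    (hIm.const_mul _) (lintegral_posteriorLoss_ne_top μ θ s i) h1 h2 h3

end Prediction

/-! ### Information scores when all predictions are posteriors -/

section InfoScore

variable {S : Type*} [Fintype S] {μ : Measure (stdSimplex ℝ S)} [IsProbabilityMeasure μ]
  {θ : S → stdSimplex ℝ S} (f : ℝ → ℝ)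

lemma infoScore_eq {x : Play S} (hsig : HasFreq (fun k => signal k x) (state x))
    (hrep : HasFreq (fun k => repSignal k x) (garble θ (state x)))
    (hpred : ∀ k, repPred k x = garble θ (posterior μ (signal k x))) (i : ℕ) :
    infoScore f i x
      = ((∑ b, state x b * f (ratio μ θ b (state x) (repSignal i x)) : ℝ) : EReal) := by
  have h := agentAvg_eq_of_tendsto {i}
    (hsig.tendsto_avg fun b => f (ratio μ θ b (state x) (repSignal i x)))
  rw [← h]
  simp only [infoScore, infoScoreRef, hpred, hrep.frac_eq, ratio]

lemma agentAvg_infoScore_eq {x : Play S} (hsig : HasFreq (fun k => signal k x) (state x))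
    (hrep : HasFreq (fun k => repSignal k x) (garble θ (state x)))
    (hpred : ∀ k, repPred k x = garble θ (posterior μ (signal k x))) :
    agentAvg ∅ (fun i => infoScore f i x) = ((avgScore μ f θ (state x) : ℝ) : EReal) := by
  simp_rw [infoScore_eq f hsig hrep hpred]
  rw [agentAvg_eq_of_tendsto ∅
    (hrep.tendsto_avg fun a => ∑ b, state x b * f (ratio μ θ b (state x) a))]
  simp only [avgScore, Finset.mul_sum, mul_assoc]

variable {f}

lemma slopeAtTop_eq_zero (h : Tendsto (fun t => f t / t) atTop (𝓝 0)) : slopeAtTop f = 0 :=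
  ((continuous_coe_real_ereal.tendsto 0).comp h).limsup_eq

lemma slopeAtTop_eq_zero_or (θ : S → stdSimplex ℝ S)
    (hreg : Tendsto (fun t => f t / t) atTop (𝓝 0) ∨ PosteriorSupported μ) :
    slopeAtTop f = 0 ∨
      ∀ᵐ w ∂μ, ∀ b a, 0 < w b → 0 < garble θ (posterior μ b) a → 0 < garble θ w a :=
  hreg.imp slopeAtTop_eq_zero fun h => h.ae_garble_pos θ

variable [MeasurableSpace S] {s : ℕ → Strategy S}

lemma map_state_playLaw (μ : Measure (stdSimplex ℝ S)) (s : ℕ → Strategy S) :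
    (playLaw μ s).map state = μ := by
  refine Measure.ext_of_lintegral _ fun H hH => ?_
  rw [lintegral_map hH measurable_state,
    lintegral_playLaw μ s (H := fun x => H (state x)) (hH.comp measurable_state)]
  simp [state]

variable [DiscreteMeasurableSpace S]

lemma expAvgInfoScore_eq (hf : ConvexOn ℝ (Ioi 0) f)
    (hrep : ∀ᵐ x ∂playLaw μ s, HasFreq (fun k => repSignal k x) (garble θ (state x)))
    (hpred : ∀ᵐ x ∂playLaw μ s, ∀ k, repPred k x = garble θ (posterior μ (signal k x))) :
    expAvgInfoScore μ f s = garbledInfo μ f θ := by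
  have hm : Measurable fun w => ((avgScore μ f θ w : ℝ) : EReal) :=
    (Finset.measurable_sum _ fun a _ => Finset.measurable_sum _ fun b _ =>
      ((measurable_garble_apply θ a).mul (measurable_coord b)).mul
        (measurable_comp_ratio μ θ hf b a)).coe_real_ereal
  have h : ∀ᵐ x ∂playLaw μ s,
      agentAvg ∅ (fun i => infoScore f i x) = ((avgScore μ f θ (state x) : ℝ) : EReal) := by
    filter_upwards [ae_hasFreq_signal μ s, hrep, hpred] with x h1 h2 h3
    exact agentAvg_infoScore_eq f h1 h2 h3
  rw [← expect_avgScore μ θ hf, expAvgInfoScore, expect_congr h]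
  have e := expect_map (P := playLaw μ s) measurable_state hm
  rw [map_state_playLaw] at e
  exact e.symm

/-- The signal of a randomly picked agent, given the state, is drawn from the garbled state. -/
lemma condFMI_pickLaw (hf : ConvexOn ℝ (Ioi 0) f)
    (hreg : Tendsto (fun t => f t / t) atTop (𝓝 0) ∨ PosteriorSupported μ)
    (hrep : ∀ᵐ x ∂playLaw μ s, HasFreq (fun k => repSignal k x) (garble θ (state x))) (j : ℕ) :
    condFMI f (pickLaw μ s) (fun y => reportDist y.1) (fun y => y.2) (fun y => signal j y.1)
      = garbledInfo μ f θ := by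
  refine condFMI_eq_garbledInfo (X₀ := fun w a => garble θ w a)
    (G := fun v a => ENNReal.ofReal (v a)) hf (fun a => (measurable_pi_apply a).ennreal_ofReal)
    (fun w a => rfl) (slopeAtTop_eq_zero_or θ hreg) (measurable_reportDist.comp measurable_fst)
    measurable_snd ((measurable_signal j).comp measurable_fst) fun F hF => ?_
  have hX₀ : Measurable fun (w : stdSimplex ℝ S) a => garble θ w a :=
    measurable_pi_lambda _ fun a => measurable_garble_apply θ a
  have hFm : ∀ a, Measurable fun x : Play S => F (reportDist x) a (signal j x) := fun a =>
    measurable_apply_discrete (hF a) measurable_reportDist (measurable_signal j)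
  have hFm' : Measurable fun y : Play S × S => F (reportDist y.1) y.2 (signal j y.1) :=
    measurable_from_prod_countable_left hFm
  have hG : ∀ a b, Measurable fun w : stdSimplex ℝ S =>
      ENNReal.ofReal (garble θ w a) * F (fun c => garble θ w c) a b := fun a b =>
    (measurable_garble_apply θ a).ennreal_ofReal.mul ((hF a b).comp hX₀)
  rw [pickLaw, lintegral_finsetSum_measure]
  have hterm : ∀ a, ∫⁻ y, F (reportDist y.1) y.2 (signal j y.1) ∂Measure.map (fun x => (x, a))
        ((playLaw μ s).withDensity fun x => ENNReal.ofReal (reportDist x a))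
      = ∫⁻ w, ∑ b, ENNReal.ofReal (garble θ w a) * ENNReal.ofReal (w b)
        * F (fun c => garble θ w c) a b ∂μ := by
    intro a
    have hd : Measurable fun x : Play S => ENNReal.ofReal (reportDist x a) :=
      ((measurable_pi_apply a).comp measurable_reportDist).ennreal_ofReal
    rw [lintegral_map hFm' measurable_prodMk_right,
      lintegral_withDensity_eq_lintegral_mul _ hd (hFm a)]
    have e := lintegral_playLaw_signal μ s j
      (F := fun w b => ENNReal.ofReal (garble θ w a) * F (fun c => garble θ w c) a b) (hG a)
    refine (lintegral_congr_ae ?_).trans (e.trans (lintegral_congr fun w =>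
      Finset.sum_congr rfl fun b _ => by ring))
    filter_upwards [hrep] with x hx
    have hd : reportDist x = fun c => garble θ (state x) c := funext fun c => hx.frac_eq ∅ c
    simp only [Pi.mul_apply, hd]
  simp_rw [hterm]
  rw [lintegral_finsetSum]
  intro a _
  exact Finset.measurable_sum _ fun b _ => by
    simp_rw [mul_right_comm]
    exact (hG a b).mul (measurable_coord b).ennreal_ofReal

end InfoScore

/-! ### Truth-telling -/

section Truth

variable {S : Type*} [Fintype S] [MeasurableSpace S] [DiscreteMeasurableSpace S]
  (μ : Measure (stdSimplex ℝ S)) [IsProbabilityMeasure μ]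

lemma ae_truth_report (i : ℕ) : ∀ᵐ x ∂playLaw μ (truth μ), ∀ a,
    repSignal i x = signal i x ∧ repPred i x a = posterior μ (signal i x) a := by
  rw [ae_all_iff]
  intro a
  set A : Set (S × Report S) := {p | ¬ (p.2.1 = p.1 ∧ p.2.2 a = posterior μ p.1 a)} with hA
  have hAm : MeasurableSet A := by
    refine ((measurableSet_eq_fun (measurable_fst.comp measurable_snd) measurable_fst).inter
      (measurableSet_eq_fun ((measurable_coord a).comp (measurable_snd.comp measurable_snd))
        ((measurable_of_finite fun b => posterior μ b a).comp measurable_fst))).compl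
  have h := lintegral_playLaw_agent μ (truth μ) i
    (H := fun p => A.indicator 1 p.2) ((measurable_one.indicator hAm).comp measurable_snd)
  have hz : ∀ b, ∫⁻ r, A.indicator (1 : S × Report S → ℝ≥0∞) (b, r)
      ∂(truth μ i b : Measure (Report S)) = 0 := fun b => by
    change ∫⁻ r, A.indicator (1 : S × Report S → ℝ≥0∞) (b, r)
      ∂(Measure.dirac (b, posterior μ b)) = 0
    rw [lintegral_dirac' _ (f := fun r => A.indicator (1 : S × Report S → ℝ≥0∞) (b, r))
      ((measurable_one.indicator hAm).comp measurable_prodMk_left)]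
    simp [hA]
  simp only [hz, mul_zero, Finset.sum_const_zero, lintegral_const, zero_mul] at h
  rw [ae_iff]
  change playLaw μ (truth μ) ((fun x => x.2 i) ⁻¹' A) = 0
  rw [← lintegral_indicator_one (measurable_agent i hAm), ← h]
  rfl

lemma ae_truth : ∀ᵐ x ∂playLaw μ (truth μ),
    HasFreq (fun k => repSignal k x) (garble idChannel (state x)) ∧
    (∀ k, repPred k x = garble idChannel (posterior μ (signal k x))) ∧
    ∀ k, repSignal k x = signal k x := by
  have h : ∀ᵐ x ∂playLaw μ (truth μ), ∀ i a,
      repSignal i x = signal i x ∧ repPred i x a = posterior μ (signal i x) a :=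
    ae_all_iff.2 (ae_truth_report μ)
  filter_upwards [h, ae_hasFreq_signal μ (truth μ)] with x hx hfreq
  have hrep : ∀ k, repSignal k x = signal k x := fun k => (hx k (signal k x)).1
  simp only [garble_idChannel, hrep]
  exact ⟨hfreq, fun k => simplex_ext fun a => (hx k a).2, fun _ => trivial⟩

variable {μ} {f : ℝ → ℝ}

lemma expAvgInfoScore_truth (hf : ConvexOn ℝ (Ioi 0) f) :
    expAvgInfoScore μ f (truth μ) = garbledInfo μ f idChannel :=
  expAvgInfoScore_eq hf ((ae_truth μ).mono fun _ h => h.1) ((ae_truth μ).mono fun _ h => h.2.1)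

/-- The positive part of the summands of the information score that an agent with signal `a`
receives in the state `w` under truth-telling. -/
def truthScore (μ : Measure (stdSimplex ℝ S)) [IsProbabilityMeasure μ] (g : ℝ → ℝ)
    (w : stdSimplex ℝ S) (a : S) : ℝ≥0∞ :=
  ∑ b, ENNReal.ofReal (w b) * ENNReal.ofReal (g (ratio μ idChannel b w a))

lemma lintegral_truthScore (i : ℕ) {g : ℝ → ℝ}
    (hg : ∀ b a, Measurable fun w => g (ratio μ idChannel b w a)) :
    Measurable (fun x : Play S => truthScore μ g (state x) (signal i x)) ∧
      ∫⁻ x, truthScore μ g (state x) (signal i x) ∂playLaw μ (truth μ)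
        = ∫⁻ w, posScore μ g idChannel w ∂μ := by
  have hm : ∀ a, Measurable fun w => truthScore μ g w a := fun a =>
    Finset.measurable_sum _ fun b _ => (measurable_coord b).ennreal_ofReal.mul
      (hg b a).ennreal_ofReal
  refine ⟨measurable_apply_discrete hm measurable_state (measurable_signal i), ?_⟩
  rw [lintegral_playLaw_signal μ (truth μ) i hm]
  simp only [posScore, garble_idChannel, truthScore, Finset.mul_sum, mul_assoc]

lemma expect_infoScore_truth (hf : ConvexOn ℝ (Ioi 0) f) (i : ℕ) :
    expect (playLaw μ (truth μ)) (infoScore f i) = garbledInfo μ f idChannel := by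
  have hscore : ∀ᵐ x ∂playLaw μ (truth μ), infoScore f i x
      = (truthScore μ f (state x) (signal i x) : EReal)
        - (truthScore μ (-f) (state x) (signal i x) : EReal) := by
    filter_upwards [ae_truth μ, ae_hasFreq_signal μ (truth μ)] with x hx hsig
    rw [infoScore_eq f hsig hx.1 hx.2.1, hx.2.2]
    exact coe_sum_mul_eq_sub _ fun b _ => coord_nonneg _ _
  obtain ⟨m1, e1⟩ := lintegral_truthScore (μ := μ) i
    fun b a => measurable_comp_ratio μ idChannel hf b a
  obtain ⟨m2, e2⟩ := lintegral_truthScore (μ := μ) (g := -f) i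
    fun b a => (measurable_comp_ratio μ idChannel hf b a).neg
  rw [expect_congr hscore, expect_sub m1.aemeasurable m2.aemeasurable, e1, e2, garbledInfo]
  rw [e2]
  exact lintegral_posScore_neg_ne_top μ idChannel hf

lemma condFMI_truth (hf : ConvexOn ℝ (Ioi 0) f)
    (hreg : Tendsto (fun t => f t / t) atTop (𝓝 0) ∨ PosteriorSupported μ) {i j : ℕ}
    (hij : i ≠ j) :
    condFMI f (playLaw μ (truth μ)) state (signal i) (signal j) = garbledInfo μ f idChannel := by
  refine condFMI_eq_garbledInfo (X₀ := id) (G := fun w a => ENNReal.ofReal (w a)) hf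
    (fun a => (measurable_coord a).ennreal_ofReal) (fun w a => by rw [garble_idChannel]; rfl)
    (slopeAtTop_eq_zero_or idChannel hreg) measurable_state (measurable_signal i)
    (measurable_signal j) fun F hF => ?_
  rw [lintegral_playLaw_signal_pair μ (truth μ) hij hF]
  simp only [garble_idChannel, id]

end Truth

end BTS
end
open BTS in
theorem theorem6p6 {S : Type*} [Fintype S] [MeasurableSpace S] [DiscreteMeasurableSpace S]
    (μ : Measure (stdSimplex ℝ S)) [IsProbabilityMeasure μ]
    (f : ℝ → ℝ) (hf : ConvexOn ℝ (Ioi 0) f)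
    (hreg : Tendsto (fun t => f t / t) atTop (𝓝 0) ∨ PosteriorSupported μ) (α : ℝ) :
    (∀ i j : ℕ, i ≠ j →
      expect (playLaw μ (truth μ)) (infoScore f i)
          = condFMI f (playLaw μ (truth μ)) state (signal i) (signal j) ∧
        expAvgInfoScore μ f (truth μ)
          = condFMI f (playLaw μ (truth μ)) state (signal i) (signal j)) ∧
    ∀ s : ℕ → Strategy S, HasReportDist μ s → IsEquilibrium μ α f s →
      (∀ j : ℕ, expAvgInfoScore μ f s
          = condFMI f (pickLaw μ s) (fun y => reportDist y.1) (fun y => y.2)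
              (fun y => signal j y.1)) ∧
        expAvgInfoScore μ f s ≤ expAvgInfoScore μ f (truth μ) := by
  refine ⟨fun i j hij => ⟨?_, ?_⟩, fun s hs heq => ?_⟩
  · rw [condFMI_truth hf hreg hij, expect_infoScore_truth hf]
  · rw [condFMI_truth hf hreg hij, expAvgInfoScore_truth hf]
  · obtain ⟨θ, hθ⟩ := hs.exists_channel
    have hpred : ∀ᵐ x ∂playLaw μ s, ∀ k, repPred k x = garble θ (posterior μ (signal k x)) :=
      ae_all_iff.2 (heq.ae_repPred_eq hf hθ)
    have hinfo := expAvgInfoScore_eq hf hθ hpred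
    refine ⟨fun j => ?_, ?_⟩
    · rw [hinfo, condFMI_pickLaw hf hreg hθ]
    · rw [hinfo, expAvgInfoScore_truth hf]
      exact garbledInfo_le μ θ hf hreg
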